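/- **Setting.** Let $\Gamma\subset SU(2)$ be a finite subgroup and $R$ its regular representation with a $\Gamma$-invariant hermitian metric; put $V=\mathrm{End}(R)$ with the metric $\langle X,Y\rangle=\mathrm{Tr}(XY^*)$. Let $F$ (resp. $F^c$) be the group of unitary (resp. invertible linear) maps of $R$ commuting with $\Gamma$, and $T\subset F$, $\mathbb C^*\subset F^c$ the scalars; $F/T$ and $F^c/\mathbb C^*$ are regarded as subgroups of $GL(V)$, acting by conjugation. Let $\mathfrak f/\mathfrak t$ be the Lie algebra of $F/T$, identified with the traceless skew-hermitian endomorphisms of $R$ commuting with $\Gamma$, and $Z$ its centre. Let $S^3\subset\mathbb C^2$ be the unit sphere, $S^2=\mathbb{CP}^1=S^3/S^1$, with $SU(2)$ acting on the right on row vectors and $J(z_1,z_2)=(-\bar z_2,\bar z_1)$, which covers the antipodal map $\tau$ of $S^2$. A section $\Theta\in C^\infty(E(\Gamma))$ of the orbifold bundle $E(\Gamma)$ over $S^2/\Gamma$ (a $\Gamma$-invariant smooth section of $H\otimes V$, with $H$ the hyperplane bundle) is a smooth map $\Theta:S^3\to V$ with $\Theta(cp)=c\,\Theta(p)$ for $|c|=1$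 and $\Theta(p\gamma)=R(\gamma)^{-1}\Theta(p)R(\gamma)$ for $\gamma\in\Gamma$; put $(J\Theta)(p)=-\Theta(Jp)^*$. Let $A_0$ be the Chern connection of $H$ (with its standard metric and holomorphic structure), and let $\omega_{vol}$ be the Fubini–Study form on $\mathbb{CP}^1$, with any fixed positive normalization. Let $\mathcal G^{F,\Gamma}_\tau$ (resp. $\mathcal G^{F,\Gamma}_{\tau,\mathbb C}$) be the group of smooth $\Gamma$-invariant and $\tau$-invariant maps $S^2\to F/T$ (resp. $S^2\to F^c/\mathbb C^*$). Let $\mathcal A^F_\tau$ be the space of connections $A_0+B$ with $B=\kappa^*\partial\kappa^{*-1}+\kappa^{-1}\bar\partial\kappa$, $\kappa\in\mathcal G^{F,\Gamma}_{\tau,\mathbb C}$; here $B$ is a $\Gamma$-invariant $\mathfrak f/\mathfrak t$-valued one-form on $S^2$, acting on $V$ by commutators. An element $\rho\in\mathcal G^{F,\Gamma}_\tau$ acts by $\rho\cdot(B,\Theta)=(B+\rho\, d_B\rho^{-1},\ \rho\Theta\rho^{-1})$, and $\kappa\in\mathcal G^{F,\Gamma}_{\tau,\mathbb C}$ acts by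 $\kappa\cdot(B,\Theta)=(B',\kappa\Theta\kappa^{-1})$, where $\bar\partial_{B'}=\kappa\circ\bar\partial_B\circ\kappa^{-1}$ and $\partial_{B'}=\kappa^{*-1}\circ\partial_B\circ\kappa^{*}$. **Theorem (Uniqueness theorem 2).** Let $\tilde\zeta_1,\tilde\zeta_2,\tilde\zeta_3\in Z$, and let $(B_1,\Theta_1),(B_2,\Theta_2)\in\mathcal A^F_\tau\times C^\infty(E(\Gamma))$ both be solutions of $$\bar\partial_{A_0+B}\Theta=0,\qquad F_B-\tfrac i2[\Theta,\Theta^*]\,\omega_{vol}=\tilde\zeta_1\,\omega_{vol},$$ $$-\tfrac14\big([J\Theta,\Theta^*]-[\Theta,(J\Theta)^*]\big)\omega_{vol}=\tilde\zeta_2\,\omega_{vol},\qquad -\tfrac i4\big([J\Theta,\Theta^*]+[\Theta,(J\Theta)^*]\big)\omega_{vol}=\tilde\zeta_3\,\omega_{vol}.$$ If $\kappa\in\mathcal G^{F,\Gamma}_{\tau,\mathbb C}$ satisfies $\kappa\cdot(B_1,\Theta_1)=(B_2,\Theta_2)$, then the unitary part $\rho=\kappa(\kappa^*\kappa)^{-1/2}$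 of $\kappa$ lies in $\mathcal G^{F,\Gamma}_\tau$ (in particular it is $\tau$-invariant) and $\rho\cdot(B_1,\Theta_1)=(B_2,\Theta_2)$. In particular, two solutions on the same $\mathcal G^{F,\Gamma}_{\tau,\mathbb C}$-orbit lie on the same $\mathcal G^{F,\Gamma}_\tau$-orbit. -/

import Mathlib

open scoped Manifold ContDiff Matrix ComplexConjugate MatrixGroups ComplexOrder

noncomputable section

namespace ALE

/-! ### The Hopf bundle `S³ → S² = ℂP¹`

Everything on `S² = S³ / S¹` (and on the orbifold `S² / Γ`) is described by the corresponding
equivariant object on `S³ ⊂ ℂ²`. -/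

/-- The hermitian plane `ℂ²`. -/
abbrev C2 : Type := EuclideanSpace ℂ (Fin 2)

instance finrankC2 : Fact (Module.finrank ℝ C2 = 3 + 1) :=
  ⟨by rw [finrank_real_of_complex]; simp⟩

/-- The unit sphere `S³ ⊂ ℂ²`, with Mathlib's structure of a smooth manifold. -/
abbrev S3 : Type := Metric.sphere (0 : C2) 1

theorem mem_S3 (z : C2) : z ∈ Metric.sphere (0 : C2) 1 ↔
    Complex.normSq (z 0) + Complex.normSq (z 1) = 1 := by
  rw [mem_sphere_zero_iff_norm, EuclideanSpace.norm_eq, Real.sqrt_eq_one, Fin.sum_univ_two,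
    Complex.normSq_eq_norm_sq, Complex.normSq_eq_norm_sq]

/-- A function on `S³` is smooth. -/
def SmoothS3 (f : S3 → ℂ) : Prop := ContMDiff (𝓡 3) 𝓘(ℝ, ℂ) ∞ f

/-- The quaternionic action of `J` on `ℂ²`: `J (z₁, z₂) = (-z₂*, z₁*)`. -/
def jC2 (z : C2) : C2 := !₂[-conj (z 1), conj (z 0)]

/-- The quaternionic action of `K` on `ℂ²`: `K (z₁, z₂) = (-i z₂*, i z₁*)`. -/
def kC2 (z : C2) : C2 := !₂[-(Complex.I * conj (z 1)), Complex.I * conj (z 0)]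

/-- `J` on `S³`; it covers the antipodal map `τ [z₁ : z₂] = [-z₂* : z₁*]` of `ℂP¹`. -/
def jS3 (p : S3) : S3 := ⟨jC2 p, by
  have h := (mem_S3 _).1 p.2
  rw [mem_S3]
  simp [jC2, Complex.normSq_conj]
  linarith⟩

/-- The action of the unit complex numbers on `S³`, whose orbits are the fibres of
`S³ → ℂP¹`. -/
def circ (c : Circle) (p : S3) : S3 := ⟨(c : ℂ) • (p : C2), by
  have h := (mem_S3 _).1 p.2
  rw [mem_S3]
  have hc : Complex.normSq (c : ℂ) = 1 := Circle.normSq_coe c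
  simpa [Complex.normSq_mul, hc] using h⟩

/-- The group `SU(2)`. -/
abbrev SU2 : Type := Matrix.specialUnitaryGroup (Fin 2) ℂ

/-- The right action of `SU(2)` on `ℂ²`: row vector times matrix. -/
def rightC2 (z : C2) (γ : SU2) : C2 :=
  WithLp.toLp 2 ((z : Fin 2 → ℂ) ᵥ* (γ : Matrix (Fin 2) (Fin 2) ℂ))

/-- The right action of `SU(2)` on `S³`. -/
def rightS3 (p : S3) (γ : SU2) : S3 := ⟨rightC2 p γ, by
  have h := (mem_S3 _).1 p.2
  have hu := (Matrix.mem_unitaryGroup_iff.1 (Matrix.mem_specialUnitaryGroup_iff.1 γ.2).1)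
  have h00 := congrFun (congrFun hu 0) 0
  have h01 := congrFun (congrFun hu 0) 1
  have h10 := congrFun (congrFun hu 1) 0
  have h11 := congrFun (congrFun hu 1) 1
  simp [Matrix.mul_apply, Fin.sum_univ_two, Matrix.star_apply] at h00 h01 h10 h11
  rw [mem_S3]
  rw [← Complex.ofReal_inj] at h ⊢
  simp [rightC2, Matrix.vecMul, dotProduct, Fin.sum_univ_two, Complex.normSq_eq_conj_mul_self]
    at h ⊢
  linear_combination h + conj ((p : C2) 0) * (p : C2) 0 * h00 + conj ((p : C2) 1) * (p : C2) 1 * h11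
    + conj ((p : C2) 1) * (p : C2) 0 * h01 + conj ((p : C2) 0) * (p : C2) 1 * h10⟩

/-- The great circle `t ↦ cos t · p + sin t · J p`; its velocity at `t = 0` is `J p`. -/
def jCurve (p : S3) (t : ℝ) : S3 := ⟨Real.cos t • (p : C2) + Real.sin t • jC2 p, by
  have h := (mem_S3 _).1 p.2
  have ht := Real.sin_sq_add_cos_sq t
  rw [mem_S3]
  generalize Real.sin t = s at ht ⊢
  generalize Real.cos t = r at ht ⊢
  simp [jC2, Complex.normSq_apply] at h ⊢
  linear_combination (s ^ 2 + r ^ 2) * h + ht⟩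

/-- The great circle `t ↦ cos t · p + sin t · K p`; its velocity at `t = 0` is `K p`. -/
def kCurve (p : S3) (t : ℝ) : S3 := ⟨Real.cos t • (p : C2) + Real.sin t • kC2 p, by
  have h := (mem_S3 _).1 p.2
  have ht := Real.sin_sq_add_cos_sq t
  rw [mem_S3]
  generalize Real.sin t = s at ht ⊢
  generalize Real.cos t = r at ht ⊢
  simp [kC2, Complex.normSq_apply] at h ⊢
  linear_combination (s ^ 2 + r ^ 2) * h + ht⟩

variable {Γ : Subgroup SU2} {ι : Type*} [Fintype ι] [DecidableEq ι]

/-! ### Derivatives along the horizontal frame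

The hermitian structure and the holomorphic structure of the hyperplane bundle `H` determine the
Chern connection `A₀`: its horizontal space at `p ∈ S³` is the hermitian orthogonal complement of
`p`, which has the real basis `J p`, `K p = i (J p)`. A form on `S²` is determined by the values of
its pullback to `S³` on this frame, and the covariant derivative `d_{A₀}` of a section along the
frame is the derivative of the corresponding equivariant function. The complex structure of `S²` is
multiplication by `i` on the horizontal space, so the `(0,1)` and `(1,0)` parts of a one-form `η`
have the values `(η (J p) + i η (K p)) / 2` and `(η (J p) - i η (K p)) / 2` on `J p`
(and `-i`, respectively `i`, times these values on `K p`). -/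

/-- Derivative at `p` of a matrix-valued function in the direction `J p`. -/
def dJ (f : S3 → Matrix ι ι ℂ) (p : S3) : Matrix ι ι ℂ :=
  Matrix.of fun a b => deriv (fun t : ℝ => f (jCurve p t) a b) 0

/-- Derivative at `p` of a matrix-valued function in the direction `K p`. -/
def dK (f : S3 → Matrix ι ι ℂ) (p : S3) : Matrix ι ι ℂ :=
  Matrix.of fun a b => deriv (fun t : ℝ => f (kCurve p t) a b) 0

/-- The value of `∂̄ f` (with respect to `A₀`) on `J p`. -/
def dbar (f : S3 → Matrix ι ι ℂ) (p : S3) : Matrix ι ι ℂ :=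
  (1 / 2 : ℂ) • (dJ f p + Complex.I • dK f p)

/-- The value of `∂ f` (with respect to `A₀`) on `J p`. -/
def del (f : S3 → Matrix ι ι ℂ) (p : S3) : Matrix ι ι ℂ :=
  (1 / 2 : ℂ) • (dJ f p - Complex.I • dK f p)

/-! ### The representation `R` and the groups `F`, `F / T`, `F^c / ℂ*` -/

/-- The unitary matrix representation `R` is (equivalent to) the regular representation. -/
def IsRegular (R : Γ →* Matrix.unitaryGroup ι ℂ) : Prop :=
  ∃ e : (ι → ℂ) ≃ₗ[ℂ] (Γ → ℂ), ∀ (γ : Γ) (v : ι → ℂ) (δ : Γ),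
    e ((R γ : Matrix ι ι ℂ) *ᵥ v) δ = e v (γ⁻¹ * δ)

/-- The matrix `A` commutes with the action of `Γ`. -/
def CommutesWith (R : Γ →* Matrix.unitaryGroup ι ℂ) (A : Matrix ι ι ℂ) : Prop :=
  ∀ γ : Γ, A * (R γ : Matrix ι ι ℂ) = (R γ : Matrix ι ι ℂ) * A

/-- The Lie algebra `𝔣 / 𝔱` of `F / T`, identified with the traceless elements of `𝔣`: the
traceless skew-hermitian matrices that commute with `Γ`. -/
def lieFT (R : Γ →* Matrix.unitaryGroup ι ℂ) : Set (Matrix ι ι ℂ) :=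
  {A | Aᴴ = -A ∧ CommutesWith R A ∧ A.trace = 0}

/-- The centre `Z` of `𝔣 / 𝔱`. -/
def centreFT (R : Γ →* Matrix.unitaryGroup ι ℂ) : Set (Matrix ι ι ℂ) :=
  {A | A ∈ lieFT R ∧ ∀ C ∈ lieFT R, A * C = C * A}

/-- The conjugation `X ↦ f X f⁻¹` of `V = End(R)`. Its kernel is the group of scalars, so that
`F / T` and `F^c / ℂ*` are subgroups of `GL(V)`. -/
def conjGL (f : GL ι ℂ) : Matrix ι ι ℂ ≃ₗ[ℂ] Matrix ι ι ℂ where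
  toFun X := (f : Matrix ι ι ℂ) * X * ((f⁻¹ : GL ι ℂ) : Matrix ι ι ℂ)
  invFun X := ((f⁻¹ : GL ι ℂ) : Matrix ι ι ℂ) * X * (f : Matrix ι ι ℂ)
  map_add' X Y := by simp [mul_add, add_mul]
  map_smul' c X := by simp
  left_inv X := by simp [← mul_assoc]
  right_inv X := by simp [← mul_assoc]

/-- `F^c / ℂ*`, inside `GL(V)`. -/
def FcModC (R : Γ →* Matrix.unitaryGroup ι ℂ) : Set (Matrix ι ι ℂ ≃ₗ[ℂ] Matrix ι ι ℂ) :=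
  {φ | ∃ f : GL ι ℂ, CommutesWith R f ∧ φ = conjGL f}

/-- `F / T`, inside `GL(V)`. -/
def FModT (R : Γ →* Matrix.unitaryGroup ι ℂ) : Set (Matrix ι ι ℂ ≃ₗ[ℂ] Matrix ι ι ℂ) :=
  {φ | ∃ f : GL ι ℂ, (f : Matrix ι ι ℂ) ∈ Matrix.unitaryGroup ι ℂ ∧ CommutesWith R f ∧
    φ = conjGL f}

/-- The adjoint of a linear map `L : V → V` for the hermitian metric `⟨X, Y⟩ = Tr (X Y*)`. -/
def adj (L : Matrix ι ι ℂ →ₗ[ℂ] Matrix ι ι ℂ) (Y : Matrix ι ι ℂ) : Matrix ι ι ℂ :=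
  Matrix.of fun a b => (Y * (L (Matrix.single a b 1))ᴴ).trace

theorem trace_adj (L : Matrix ι ι ℂ →ₗ[ℂ] Matrix ι ι ℂ) (X Y : Matrix ι ι ℂ) :
    (L X * Yᴴ).trace = (X * (adj L Y)ᴴ).trace := by
  have key : ∀ a b, star (adj L Y a b) = (L (Matrix.single a b 1) * Yᴴ).trace := by
    intro a b
    simp only [adj, Matrix.of_apply]
    rw [← Matrix.trace_conjTranspose, Matrix.conjTranspose_mul, Matrix.conjTranspose_conjTranspose]
  have hX : L X = ∑ a, ∑ b, X a b • L (Matrix.single a b 1) := by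
    conv_lhs => rw [Matrix.matrix_eq_sum_single X]
    simp only [map_sum]
    refine Finset.sum_congr rfl fun a _ => Finset.sum_congr rfl fun b _ => ?_
    rw [← map_smul, Matrix.smul_single, smul_eq_mul, mul_one]
  rw [hX]
  simp only [Finset.sum_mul, Matrix.trace_sum, Matrix.smul_mul, Matrix.trace_smul, smul_eq_mul]
  rw [Matrix.trace]
  simp only [Matrix.diag_apply, Matrix.mul_apply, Matrix.conjTranspose_apply, key]

/-! ### Gauge groups -/

/-- Smooth orbifold maps from `S² / Γ` to `GL(V)`: smooth maps on `S³` that are invariant under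
`S¹` and `Γ`. -/
def smoothMaps (Γ : Subgroup SU2) (ι : Type*) [Fintype ι] [DecidableEq ι] :
    Set (S3 → Matrix ι ι ℂ ≃ₗ[ℂ] Matrix ι ι ℂ) :=
  {κ | (∀ X a b, SmoothS3 fun p => κ p X a b) ∧ (∀ c p, κ (circ c p) = κ p) ∧
    ∀ γ ∈ Γ, ∀ p, κ (rightS3 p γ) = κ p}

/-- Invariance under the antipodal map `τ` of `S²`. -/
def tauInvariant (ι : Type*) [Fintype ι] [DecidableEq ι] :
    Set (S3 → Matrix ι ι ℂ ≃ₗ[ℂ] Matrix ι ι ℂ) :=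
  {κ | ∀ p, κ (jS3 p) = κ p}

/-- The `τ`-invariant gauge group, a subgroup of `Map (S² / Γ, F / T)`. -/
def gaugeTau (R : Γ →* Matrix.unitaryGroup ι ℂ) : Set (S3 → Matrix ι ι ℂ ≃ₗ[ℂ] Matrix ι ι ℂ) :=
  {ρ | ρ ∈ smoothMaps Γ ι ∧ (∀ p, ρ p ∈ FModT R) ∧ ρ ∈ tauInvariant ι}

/-- The complexified `τ`-invariant gauge group, a subgroup of `Map (S² / Γ, F^c / ℂ*)`. -/
def gaugeTauC (R : Γ →* Matrix.unitaryGroup ι ℂ) : Set (S3 → Matrix ι ι ℂ ≃ₗ[ℂ] Matrix ι ι ℂ) :=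
  {κ | κ ∈ smoothMaps Γ ι ∧ (∀ p, κ p ∈ FcModC R) ∧ κ ∈ tauInvariant ι}

/-- `ρ` is the unitary part `κ (κ* κ)^{-1/2}` in the pointwise polar decomposition of `κ`. -/
def IsUnitaryPart (R : Γ →* Matrix.unitaryGroup ι ℂ)
    (κ ρ : S3 → Matrix ι ι ℂ ≃ₗ[ℂ] Matrix ι ι ℂ) : Prop :=
  ∀ p, ∃ u h : GL ι ℂ, (u : Matrix ι ι ℂ) ∈ Matrix.unitaryGroup ι ℂ ∧ CommutesWith R u ∧
    (h : Matrix ι ι ℂ).PosDef ∧ CommutesWith R h ∧ κ p = conjGL (u * h) ∧ ρ p = conjGL u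

/-! ### Sections and connections -/

/-- Smooth orbifold sections `Θ : x ↦ [p, Θ p]` of `E(Γ)`, that is, `Γ`-invariant smooth sections
of `E(V)`, `V = End(R)`, as equivariant functions on `S³`. (The action of `e^{iθ}` on the principal
bundle is multiplication by `e^{-iθ}`, so the equivariance reads `Θ (c p) = c Θ (p)`.) -/
structure OrbSection (R : Γ →* Matrix.unitaryGroup ι ℂ) where
  toFun : S3 → Matrix ι ι ℂ
  smooth : ∀ a b, SmoothS3 fun p => toFun p a b
  circle_equivariant : ∀ (c : Circle) (p : S3), toFun (circ c p) = (c : ℂ) • toFun p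
  gamma_equivariant : ∀ (γ : Γ) (p : S3), toFun (rightS3 p γ) =
    (R γ⁻¹ : Matrix ι ι ℂ) * toFun p * (R γ : Matrix ι ι ℂ)

/-- Smooth one-forms on `S² / Γ` with values in `𝔣 / 𝔱`, pulled back to `S³`: invariant under `S¹`
and `Γ` and zero on the vertical direction. The form at `p` is extended from the tangent space of
`S³` to `ℂ²` by zero on the normal direction, so that it is zero on `ℂ p`. -/
structure OneForm (R : Γ →* Matrix.unitaryGroup ι ℂ) where
  toFun : S3 → C2 →ₗ[ℝ] Matrix ι ι ℂ
  smooth : ∀ v a b, SmoothS3 fun p => toFun p v a b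
  mem_lie : ∀ p v, toFun p v ∈ lieFT R
  horizontal : ∀ (p : S3) (c : ℂ), toFun p (c • (p : C2)) = 0
  circle_invariant : ∀ (c : Circle) (p : S3) (v : C2), toFun (circ c p) ((c : ℂ) • v) = toFun p v
  gamma_invariant : ∀ γ ∈ Γ, ∀ (p : S3) (v : C2), toFun (rightS3 p γ) (rightC2 v γ) = toFun p v

section

variable {R : Γ →* Matrix.unitaryGroup ι ℂ}

/-- The value of `B` on `J p`. -/
def OneForm.onJ (B : OneForm R) (p : S3) : Matrix ι ι ℂ := B.toFun p (jC2 p)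

/-- The value of `B` on `K p`. -/
def OneForm.onK (B : OneForm R) (p : S3) : Matrix ι ι ℂ := B.toFun p (kC2 p)

/-- The value of the `(0,1)` part of `B` on `J p`. -/
def OneForm.part01 (B : OneForm R) (p : S3) : Matrix ι ι ℂ :=
  (1 / 2 : ℂ) • (B.onJ p + Complex.I • B.onK p)

/-- The value of the `(1,0)` part of `B` on `J p`. -/
def OneForm.part10 (B : OneForm R) (p : S3) : Matrix ι ι ℂ :=
  (1 / 2 : ℂ) • (B.onJ p - Complex.I • B.onK p)

/-- The curvature `F_B = dB + B ∧ B`, evaluated on the pair `(J p, K p)`. (The bracket of the vector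
fields `J p` and `K p` is vertical, so `B` vanishes on it.) -/
def OneForm.curvature (B : OneForm R) (p : S3) : Matrix ι ι ℂ :=
  dJ B.onK p - dK B.onJ p + (B.onJ p * B.onK p - B.onK p * B.onJ p)

end

/-- The space `𝒜^F_τ` of connections `A₀ + B`, `B = κ* ∂ κ*⁻¹ + κ⁻¹ ∂̄ κ` with `κ` in the
complexified `τ`-invariant gauge group. Forms with values in the Lie algebra act on `V` by
commutators, and the equation is the equality of the two sides as operators on `V`. -/
def connTau (R : Γ →* Matrix.unitaryGroup ι ℂ) : Set (OneForm R) :=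
  {B | ∃ κ ∈ gaugeTauC R, ∀ (p : S3) (X : Matrix ι ι ℂ),
    ⁅B.part01 p, X⁆ = (κ p)⁻¹ (dbar (fun q => κ q X) p) ∧
    ⁅B.part10 p, X⁆ =
      adj (κ p : Matrix ι ι ℂ →ₗ[ℂ] Matrix ι ι ℂ)
        (del (fun q => adj ((κ q)⁻¹ : Matrix ι ι ℂ ≃ₗ[ℂ] Matrix ι ι ℂ) X) p)}

/-- `(B', Θ') = ρ · (B, Θ) = (B + ρ d_B ρ⁻¹, ρ Θ ρ⁻¹)`; as operators on `V`,
`B' = ρ B ρ⁻¹ + ρ d ρ⁻¹`. For the section, `ρ Θ ρ⁻¹` is the action of `ρ ∈ GL(V)` on `Θ`. -/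
def UnitaryAct {R : Γ →* Matrix.unitaryGroup ι ℂ} (ρ : S3 → Matrix ι ι ℂ ≃ₗ[ℂ] Matrix ι ι ℂ)
    (B : OneForm R) (Θ : OrbSection R) (B' : OneForm R) (Θ' : OrbSection R) : Prop :=
  (∀ (p : S3) (X : Matrix ι ι ℂ),
    ⁅B'.onJ p, X⁆ = ρ p ⁅B.onJ p, (ρ p)⁻¹ X⁆ + ρ p (dJ (fun q => (ρ q)⁻¹ X) p) ∧
    ⁅B'.onK p, X⁆ = ρ p ⁅B.onK p, (ρ p)⁻¹ X⁆ + ρ p (dK (fun q => (ρ q)⁻¹ X) p)) ∧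
  ∀ p, Θ'.toFun p = ρ p (Θ.toFun p)

/-- `(B', Θ') = κ · (B, Θ)` for a complex gauge transformation `κ`: the operator `∂̄_B'` is
`κ ∘ ∂̄_B ∘ κ⁻¹`, the operator `∂_B'` is `κ*⁻¹ ∘ ∂_B ∘ κ*`, and `Θ' = κ Θ κ⁻¹`. This extends the
action of the unitary gauge group. -/
def ComplexAct {R : Γ →* Matrix.unitaryGroup ι ℂ} (κ : S3 → Matrix ι ι ℂ ≃ₗ[ℂ] Matrix ι ι ℂ)
    (B : OneForm R) (Θ : OrbSection R) (B' : OneForm R) (Θ' : OrbSection R) : Prop :=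
  (∀ (p : S3) (X : Matrix ι ι ℂ),
    ⁅B'.part01 p, X⁆ = κ p ⁅B.part01 p, (κ p)⁻¹ X⁆ + κ p (dbar (fun q => (κ q)⁻¹ X) p) ∧
    ⁅B'.part10 p, X⁆ =
      adj ((κ p)⁻¹ : Matrix ι ι ℂ ≃ₗ[ℂ] Matrix ι ι ℂ)
        (⁅B.part10 p, adj (κ p : Matrix ι ι ℂ →ₗ[ℂ] Matrix ι ι ℂ) X⁆ +
          del (fun q => adj (κ q : Matrix ι ι ℂ →ₗ[ℂ] Matrix ι ι ℂ) X) p)) ∧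
  ∀ p, Θ'.toFun p = κ p (Θ.toFun p)

/-! ### The equations -/

/-- `(J Θ)(p) = -Θ(J p)*`. -/
def jSection (Θ : S3 → Matrix ι ι ℂ) (p : S3) : Matrix ι ι ℂ := -(Θ (jS3 p))ᴴ

/-- The four equations for `(A₀ + B, Θ)`. Two-forms on `S²` are given by their value on
`(J p, K p)`; the value of the Fubini-Study form `ω_vol` on this pair is a constant `c > 0`, which
depends on how the form is normalized. -/
structure IsSolution {R : Γ →* Matrix.unitaryGroup ι ℂ} (c : ℝ) (ζ : Fin 3 → Matrix ι ι ℂ)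
    (B : OneForm R) (Θ : OrbSection R) : Prop where
  /-- `∂̄_{A₀ + B} Θ = 0` -/
  holomorphic : ∀ p, dbar Θ.toFun p + ⁅B.part01 p, Θ.toFun p⁆ = 0
  /-- `F_B - (i/2) [Θ, Θ*] ω_vol = ζ₁ ω_vol` -/
  moment₁ : ∀ p, B.curvature p - (c : ℂ) • (Complex.I / 2) • ⁅Θ.toFun p, (Θ.toFun p)ᴴ⁆ =
    (c : ℂ) • ζ 0
  /-- `-(1/4) ([JΘ, Θ*] - [Θ, (JΘ)*]) ω_vol = ζ₂ ω_vol` -/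
  moment₂ : ∀ p, (c : ℂ) • (-(1 / 4 : ℂ)) • (⁅jSection Θ.toFun p, (Θ.toFun p)ᴴ⁆ -
    ⁅Θ.toFun p, (jSection Θ.toFun p)ᴴ⁆) = (c : ℂ) • ζ 1
  /-- `-(i/4) ([JΘ, Θ*] + [Θ, (JΘ)*]) ω_vol = ζ₃ ω_vol` -/
  moment₃ : ∀ p, (c : ℂ) • (-(Complex.I / 4)) • (⁅jSection Θ.toFun p, (Θ.toFun p)ᴴ⁆ +
    ⁅Θ.toFun p, (jSection Θ.toFun p)ᴴ⁆) = (c : ℂ) • ζ 2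

end ALE

end

noncomputable section

namespace ALE

set_option linter.unusedSectionVars false

/-! ### Calculus on `S³` through extensions that are homogeneous of degree zero -/

/-! The complex gauge transformation is treated as a bundle map between two hermitian bundles with
connection, and the Bochner method shows that it is parallel. Passing to `End V` replaces `κ` by its
matrix `K`, and each `Bᵢ` and `Θᵢ` by its commutator operator. This avoids lifting `κ` smoothly from
`F^c / ℂ*` to `F^c`. Then `∂̄K = 0` for the connection induced by `B₁` and `B₂`, `K` intertwines `φ
= ad Θ₁` with `ψ = ad Θ₂`, and `K` commutes with `ad ζ₁` because `ζ₁` is central.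

Let `D` be the (1,0) part of the covariant derivative of `K`. Commuting `∂̄` past `∂` produces the
difference of the two curvatures. The moment map equation turns it into brackets of `φ` and `ψ`, the
central terms cancel, and `trace_moment` completes a square: `∂̄ tr(K*D) = |D|² + (c/4) |ψ*K -
Kφ*|²`. The left side integrates to zero over `S³`, since the horizontal fields generate isometries.
So both squares vanish (`parallel_of_moment`): `K` is parallel and intertwines the adjoints as well.

Hence `H = K*K` is parallel for `B₁` and commutes with `φ`. A parallel endomorphism satisfies the
same polynomial identities at all points (`aeval_eq_zero_of_parallel`), so a single polynomial `q`
gives `q(H) = H^{-1/2}` everywhere (`aeval_invSqrtPoly`). The unitary part `K q(H)` is therefore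
smooth, parallel and intertwines `φ` with `ψ`. Its value at a point depends only on `κ` there, so it
inherits every invariance of `κ`, that under `τ` included. The statement returns from `End V` to `V`
because `ad` is injective up to scalars and conjugation preserves traces (`eq_of_adM_eq`). -/

theorem e0_mem : (EuclideanSpace.single 0 1 : C2) ∈ Metric.sphere (0 : C2) 1 := by simp

/-- The radial projection `ℂ² ∖ 0 → S³`. -/
def nrm (z : C2) : S3 :=
  if h : z = 0 then ⟨EuclideanSpace.single 0 1, e0_mem⟩
  else ⟨(‖z‖⁻¹ : ℝ) • z, by simp [norm_smul, h]⟩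

/-- The extension of a function on `S³` that is constant on rays. -/
def ext {F : Type*} (f : S3 → F) (z : C2) : F := f (nrm z)

theorem coe_nrm {z : C2} (h : z ≠ 0) : (nrm z : C2) = (‖z‖⁻¹ : ℝ) • z := by simp [nrm, h]

theorem S3_ne_zero (p : S3) : (p : C2) ≠ 0 := by
  intro h
  have := p.2
  rw [h] at this
  simp at this

theorem norm_S3 (p : S3) : ‖(p : C2)‖ = 1 := by simp

@[simp] theorem nrm_coe (p : S3) : nrm p = p := by
  apply Subtype.ext
  rw [coe_nrm (S3_ne_zero p)]
  simp

@[simp] theorem ext_coe {F : Type*} (f : S3 → F) (p : S3) : ext f p = f p := by simp [ext]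

theorem nrm_smul {r : ℝ} (hr : 0 < r) (z : C2) : nrm (r • z) = nrm z := by
  by_cases h : z = 0
  · simp [h]
  · apply Subtype.ext
    rw [coe_nrm h, coe_nrm (smul_ne_zero hr.ne' h), norm_smul, smul_smul]
    congr 1
    rw [Real.norm_of_nonneg hr.le]
    field_simp

theorem contMDiff_nrm (z : C2) (hz : z ≠ 0) : ContMDiffAt 𝓘(ℝ, C2) (𝓡 3) ∞ nrm z := by
  let U : TopologicalSpace.Opens C2 := ⟨{0}ᶜ, isOpen_compl_singleton⟩
  have key : ContMDiff 𝓘(ℝ, C2) (𝓡 3) ∞ (fun x : U => nrm x) := by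
    have h1 : ContMDiff 𝓘(ℝ, C2) 𝓘(ℝ, C2) ∞ (fun x : U => (‖(x : C2)‖⁻¹ : ℝ) • (x : C2)) := by
      intro x
      have hx : (x : C2) ≠ 0 := x.2
      have h2 : ContDiffAt ℝ ∞ (fun z : C2 => (‖z‖⁻¹ : ℝ) • z) x :=
        ((contDiffAt_id.norm ℝ hx).inv (by simpa using hx)).smul contDiffAt_id
      exact (h2.contMDiffAt).comp x (contMDiff_subtype_val x)
    have h3 := h1.codRestrict_sphere (n := 3) (fun x => by
      have hx : (x : C2) ≠ 0 := x.2
      simp [norm_smul, hx])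
    refine h3.congr fun x => Subtype.ext ?_
    rw [coe_nrm x.2]
    rfl
  exact (contMDiffAt_subtype_iff (U := U) (x := ⟨z, hz⟩)).1 (key ⟨z, hz⟩)

theorem SmoothS3.ext {f : S3 → ℂ} (hf : SmoothS3 f) {z : C2} (hz : z ≠ 0) :
    ContDiffAt ℝ ∞ (ext f) z :=
  (ContMDiffAt.comp z (hf (nrm z)) (contMDiff_nrm z hz)).contDiffAt

/-- Reduces smoothness on the sphere to ordinary calculus on `ℂ² ∖ 0`; every closure rule below
comes from applying it to degree-zero extensions. -/
theorem smoothS3_of {f : S3 → ℂ} (g : C2 → ℂ) (hg : ∀ z, z ≠ 0 → ContDiffAt ℝ ∞ g z)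
    (h : ∀ p : S3, f p = g p) : SmoothS3 f := by
  have : f = fun p : S3 => g p := funext h
  rw [this]
  intro p
  exact (hg p (S3_ne_zero p)).contMDiffAt.comp p (contMDiff_coe_sphere p)

theorem SmoothS3.continuous {f : S3 → ℂ} (hf : SmoothS3 f) : Continuous f :=
  ContMDiff.continuous hf

theorem smoothS3_const (c : ℂ) : SmoothS3 fun _ => c := contMDiff_const

theorem SmoothS3.add {f g : S3 → ℂ} (hf : SmoothS3 f) (hg : SmoothS3 g) :
    SmoothS3 fun p => f p + g p :=
  smoothS3_of _ (fun _ hz => (hf.ext hz).add (hg.ext hz)) (by simp)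

theorem SmoothS3.mul {f g : S3 → ℂ} (hf : SmoothS3 f) (hg : SmoothS3 g) :
    SmoothS3 fun p => f p * g p :=
  smoothS3_of _ (fun _ hz => (hf.ext hz).mul (hg.ext hz)) (by simp)

theorem SmoothS3.conj {f : S3 → ℂ} (hf : SmoothS3 f) : SmoothS3 fun p => conj (f p) :=
  smoothS3_of _ (fun _ hz => (Complex.conjCLE.contDiff.contDiffAt).comp _ (hf.ext hz)) (by simp)

theorem SmoothS3.inv {f : S3 → ℂ} (hf : SmoothS3 f) (h : ∀ p, f p ≠ 0) :
    SmoothS3 fun p => (f p)⁻¹ :=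
  smoothS3_of _ (fun _ hz => (hf.ext hz).inv (h _)) (by simp)

theorem SmoothS3.sum {κ : Type*} (s : Finset κ) {f : κ → S3 → ℂ} (hf : ∀ i ∈ s, SmoothS3 (f i)) :
    SmoothS3 fun p => ∑ i ∈ s, f i p :=
  smoothS3_of (fun z => ∑ i ∈ s, ALE.ext (f i) z)
    (fun _ hz => ContDiffAt.sum fun i hi => (hf i hi).ext hz) (by simp)

theorem SmoothS3.prod {κ : Type*} (s : Finset κ) {f : κ → S3 → ℂ} (hf : ∀ i ∈ s, SmoothS3 (f i)) :
    SmoothS3 fun p => ∏ i ∈ s, f i p :=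
  smoothS3_of (fun z => ∏ i ∈ s, ALE.ext (f i) z)
    (fun _ hz => contDiffAt_prod fun i hi => (hf i hi).ext hz) (by simp)

/-- The derivative of a function on `S³` along the vector field `p ↦ T p`. -/
def dS (T : C2 →L[ℝ] C2) (f : S3 → ℂ) (p : S3) : ℂ := fderiv ℝ (ext f) p (T p)

/-- The differential of a degree-zero function has degree -1 and `T z` has degree 1, so the defining
formula stays valid off the sphere. This is what permits a second differentiation. -/
theorem ext_dS (T : C2 →L[ℝ] C2) (f : S3 → ℂ) {z : C2} (hz : z ≠ 0) :
    ext (dS T f) z = fderiv ℝ (ext f) z (T z) := by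
  have hr : 0 < ‖z‖⁻¹ := by positivity
  have h : ext f = fun w => ext f ((‖z‖⁻¹ : ℝ) • w) := by
    funext w
    simp [ext, nrm_smul hr]
  conv_rhs => rw [h]
  rw [fderiv_comp_smul]
  simp only [ext, dS, coe_nrm hz, map_smul]
  rfl

theorem SmoothS3.dS {f : S3 → ℂ} (hf : SmoothS3 f) (T : C2 →L[ℝ] C2) : SmoothS3 (dS T f) :=
  smoothS3_of (fun z => fderiv ℝ (ALE.ext f) z (T z))
    (fun _ hz => ((hf.ext hz).fderiv_right (m := ∞) (by simp)).clm_apply T.contDiff.contDiffAt)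
    (fun _ => rfl)

section rules

variable (T : C2 →L[ℝ] C2) {f g : S3 → ℂ} (p : S3)

theorem SmoothS3.diff (hf : SmoothS3 f) : DifferentiableAt ℝ (ALE.ext f) p :=
  (hf.ext (S3_ne_zero p)).differentiableAt (by simp)

theorem dS_const (c : ℂ) : dS T (fun _ => c) p = 0 := by
  have : ext (fun _ : S3 => c) = fun _ => c := rfl
  simp [dS, this]

theorem dS_add (hf : SmoothS3 f) (hg : SmoothS3 g) :
    dS T (fun q => f q + g q) p = dS T f p + dS T g p := by
  have : ext (fun q => f q + g q) = fun z => ext f z + ext g z := rfl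
  simp [dS, this, fderiv_fun_add (hf.diff p) (hg.diff p)]

theorem dS_mul (hf : SmoothS3 f) (hg : SmoothS3 g) :
    dS T (fun q => f q * g q) p = dS T f p * g p + f p * dS T g p := by
  have : ext (fun q => f q * g q) = fun z => ext f z * ext g z := rfl
  simp [dS, this, fderiv_fun_mul (hf.diff p) (hg.diff p)]
  ring

theorem dS_conj (f : S3 → ℂ) : dS T (fun q => conj (f q)) p = conj (dS T f p) := by
  have : ext (fun q => conj (f q)) = Complex.conjCLE ∘ ext f := by
    funext z; simp [ext]
  rw [dS, this, ContinuousLinearEquiv.comp_fderiv]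
  simp [dS]

theorem dS_sum {κ : Type*} (s : Finset κ) {f : κ → S3 → ℂ} (hf : ∀ i ∈ s, SmoothS3 (f i)) :
    dS T (fun q => ∑ i ∈ s, f i q) p = ∑ i ∈ s, dS T (f i) p := by
  have : ext (fun q => ∑ i ∈ s, f i q) = fun z => ∑ i ∈ s, ext (f i) z := rfl
  simp only [dS, this]
  rw [fderiv_fun_sum (fun i hi => (hf i hi).diff p)]
  simp

/-- Derivative along a curve `t ↦ cos t · p + sin t · T p`. -/
theorem hasDerivAt_curve (hT : ∀ z, T (T z) = -z) (cur : S3 → ℝ → S3)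
    (hcur : ∀ p t, (cur p t : C2) = Real.cos t • (p : C2) + Real.sin t • T p)
    (hf : SmoothS3 f) (t : ℝ) :
    HasDerivAt (fun t => f (cur p t)) (dS T f (cur p t)) t := by
  have h1 : HasDerivAt (fun t : ℝ => (cur p t : C2)) (T (cur p t)) t := by
    have : (fun t : ℝ => (cur p t : C2)) = fun t => Real.cos t • (p : C2) + Real.sin t • T p :=
      funext (hcur p)
    rw [this, hcur]
    have h2 := ((Real.hasDerivAt_cos t).smul_const (p : C2)).add
      ((Real.hasDerivAt_sin t).smul_const (T p))
    refine HasDerivAt.congr_deriv h2 ?_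
    rw [map_add, map_smul, map_smul, hT]
    module
  have h3 := ((hf.diff (cur p t)).hasFDerivAt.comp_hasDerivAt t h1)
  have h4 : (ALE.ext f ∘ fun t => (cur p t : C2)) = fun t => f (cur p t) := by
    funext t; simp
  rw [h4] at h3
  exact h3

end rules

/-- Commutator of two of the derivatives. -/
theorem dS_comm (T S : C2 →L[ℝ] C2) {f : S3 → ℂ} (hf : SmoothS3 f) (p : S3) :
    dS S (dS T f) p - dS T (dS S f) p = fderiv ℝ (ext f) p (T (S p) - S (T p)) := by
  have key : ∀ T S : C2 →L[ℝ] C2, dS S (dS T f) p =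
      fderiv ℝ (fderiv ℝ (ext f)) p (S p) (T p) + fderiv ℝ (ext f) p (T (S p)) := by
    intro T S
    have h1 : ext (dS T f) =ᶠ[nhds (p : C2)] fun z => fderiv ℝ (ext f) z (T z) := by
      filter_upwards [isOpen_compl_singleton.mem_nhds (S3_ne_zero p)] with z hz
      exact ext_dS T f hz
    rw [dS, h1.fderiv_eq]
    have h2 : DifferentiableAt ℝ (fderiv ℝ (ext f)) (p : C2) :=
      ((hf.ext (S3_ne_zero p)).fderiv_right (m := ∞) (by simp)).differentiableAt (by simp)
    rw [fderiv_clm_apply h2 T.differentiableAt]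
    simp
    ring
  have hs : fderiv ℝ (fderiv ℝ (ext f)) p (S p) (T p) =
      fderiv ℝ (fderiv ℝ (ext f)) p (T p) (S p) := by
    have := ((hf.ext (S3_ne_zero p)).isSymmSndFDerivAt (by
      rw [minSmoothness_of_isRCLikeNormedField]
      exact WithTop.coe_le_coe.2 (le_top : (2 : ℕ∞) ≤ ⊤)))
    exact this _ _
  rw [key T S, key S T, hs, map_sub]
  ring

open MeasureTheory

/-! ### Integration over `S³` -/

/-- The rotation-invariant measure on `S³`. -/
abbrev μS3 : Measure S3 := (volume : Measure C2).toSphere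

theorem integrable_S3 {g : S3 → ℂ} (hg : Continuous g) : Integrable g μS3 :=
  hg.integrable_of_hasCompactSupport (HasCompactSupport.of_compactSpace g)

open scoped Pointwise in
-- The measure of a subset of the sphere is a multiple of the volume of the cone over it, and a
-- linear isometry carries cones to cones and preserves volume.
theorem map_toSphere (e : C2 ≃ₗᵢ[ℝ] C2) (φ : S3 → S3) (hφ : ∀ p, (φ p : C2) = e p) :
    MeasurePreserving φ μS3 μS3 := by
  have hφc : Continuous φ := by
    rw [continuous_induced_rng]
    exact (e.continuous.comp continuous_subtype_val).congr fun p => (hφ p).symm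
  refine ⟨hφc.measurable, Measure.ext fun s hs => ?_⟩
  rw [Measure.map_apply hφc.measurable hs, Measure.toSphere_apply' _ (hφc.measurable hs),
    Measure.toSphere_apply' _ hs]
  congr 1
  rw [← e.measurePreserving.measure_preimage_equiv (f := e.toMeasurableEquiv)
    (Set.Ioo (0 : ℝ) 1 • ((↑) '' s : Set C2))]
  congr 1
  ext z
  simp only [Set.mem_smul, Set.mem_preimage, Set.mem_image]
  constructor
  · rintro ⟨r, hr, _, ⟨p, hp, rfl⟩, rfl⟩
    exact ⟨r, hr, _, ⟨φ p, hp, rfl⟩, by simp [hφ]⟩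
  · rintro ⟨r, hr, _, ⟨p, hp, rfl⟩, h⟩
    have hm : e.symm (p : C2) ∈ Metric.sphere (0 : C2) 1 := by simp
    refine ⟨r, hr, _, ⟨⟨_, hm⟩, ?_, rfl⟩, ?_⟩
    · have : φ ⟨e.symm p, hm⟩ = p := Subtype.ext (by simp [hφ])
      simpa [this] using hp
    · apply e.injective
      simpa using h

/-- The integral over `S³` of a derivative along a rotation field vanishes. -/
theorem integral_dS (T : C2 →L[ℝ] C2) (hT : ∀ z, T (T z) = -z) (cur : S3 → ℝ → S3)
    (hcur : ∀ p t, (cur p t : C2) = Real.cos t • (p : C2) + Real.sin t • T p)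
    {f : S3 → ℂ} (hf : SmoothS3 f) : ∫ p, dS T f p ∂μS3 = 0 := by
  -- The flow `exp(tT)`, in closed form because `T² = -1`.
  let L (t : ℝ) : C2 →L[ℝ] C2 := Real.cos t • ContinuousLinearMap.id ℝ C2 + Real.sin t • T
  have hL : ∀ t z, L t z = Real.cos t • z + Real.sin t • T z := fun t z => by simp [L]
  have hinv : ∀ t z, L (-t) (L t z) = z := fun t z => by
    rw [hL, hL]
    simp only [map_add, map_smul, hT, Real.cos_neg, Real.sin_neg]
    have := Real.sin_sq_add_cos_sq t
    match_scalars
    · linear_combination this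
    · ring
  have hnorm : ∀ t z, ‖L t z‖ = ‖z‖ := fun t z => by
    by_cases hz : z = 0
    · simp [hz]
    · have h1 : L t (nrm z) = cur (nrm z) t := by rw [hL, hcur]
      have h2 : ‖L t (nrm z)‖ = 1 := by rw [h1, norm_S3]
      rw [coe_nrm hz, map_smul, norm_smul, norm_inv, norm_norm] at h2
      have : ‖z‖ ≠ 0 := by simpa using hz
      field_simp at h2
      exact h2
  let e (t : ℝ) : C2 ≃ₗᵢ[ℝ] C2 :=
    { toLinearEquiv := LinearEquiv.ofLinearMap (L t).toLinearMap (L (-t)).toLinearMap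
        (by ext1 z; simpa using hinv (-t) z) (by ext1 z; simpa using hinv t z)
      norm_map' := hnorm t }
  have hcont : ∀ t, Continuous fun p => cur p t := fun t => by
    rw [continuous_induced_rng]
    exact ((L t).continuous.comp continuous_subtype_val).congr fun p => by
      simp [hL, hcur]
  have hpres : ∀ t, MeasurePreserving (fun p => cur p t) μS3 μS3 := fun t =>
    map_toSphere (e t) _ fun p => by
      rw [hcur]; exact (hL t p).symm
  -- By invariance of the measure the integral along the flow is constant in `t`; differentiating it
  -- under the integral sign at `t = 0` gives the claim.
  have hconst : ∀ t, ∫ p, f (cur p t) ∂μS3 = ∫ p, f p ∂μS3 := fun t => by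
    have h := integral_map (μ := μS3) (hpres t).measurable.aemeasurable
      (f := f) hf.continuous.aestronglyMeasurable
    rw [← h, (hpres t).map_eq]
  obtain ⟨C, hC⟩ : ∃ C, ∀ p, ‖dS T f p‖ ≤ C := by
    obtain ⟨C, hC⟩ := isCompact_univ.exists_bound_of_continuousOn
      (hf.dS T).continuous.continuousOn
    exact ⟨C, fun p => hC p trivial⟩
  have h0 : ∀ p, cur p 0 = p := fun p => Subtype.ext (by simp [hcur])
  have hder := (hasDerivAt_integral_of_dominated_loc_of_deriv_le (μ := μS3)
    (F := fun t p => f (cur p t)) (F' := fun t p => dS T f (cur p t)) (x₀ := 0)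
    (s := Set.univ) (bound := fun _ => C) Filter.univ_mem
    (Filter.Eventually.of_forall fun t => (hf.continuous.comp (hcont t)).aestronglyMeasurable)
    (integrable_S3 (hf.continuous.comp (hcont 0)))
    ((hf.dS T).continuous.comp (hcont 0)).aestronglyMeasurable
    (Filter.Eventually.of_forall fun p t _ => hC _) (integrable_const C)
    (Filter.Eventually.of_forall fun p t _ => hasDerivAt_curve T p hT cur hcur hf t)).2
  simp only [hconst, h0] at hder
  exact hder.unique (hasDerivAt_const _ _)

/-- A continuous non-negative function on `S³` with integral zero vanishes. -/
theorem eq_zero_of_integral_eq_zero {g : S3 → ℂ} (hg : Continuous g) (h0 : ∀ p, 0 ≤ g p)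
    (hi : ∫ p, g p ∂μS3 = 0) (p : S3) : g p = 0 := by
  have hre : Continuous fun p => (g p).re := Complex.continuous_re.comp hg
  have hr0 : 0 ≤ fun p => (g p).re := fun p => (Complex.le_def.1 (h0 p)).1
  have hint : ∫ p, (g p).re ∂μS3 = 0 := by
    have := integral_re (integrable_S3 hg) (𝕜 := ℂ)
    simp only [hi] at this
    simpa using this
  have h1 := (integral_eq_zero_iff_of_nonneg hr0 (integrable_S3 hg).re).1 hint
  have h2 : (fun p => (g p).re) = 0 :=
    Measure.eq_of_ae_eq h1 hre continuous_zero
  refine Complex.ext (congrFun h2 p) ?_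
  exact (Complex.le_def.1 (h0 p)).2.symm

/-! ### The horizontal frame and the vertical field -/

/-- `J` as a real-linear map. -/
def jL : C2 →L[ℝ] C2 := LinearMap.toContinuousLinearMap
  { toFun := jC2
    map_add' := fun x y => by ext i; fin_cases i <;> (simp [jC2]; try ring)
    map_smul' := fun r x => by ext i; fin_cases i <;> simp [jC2] }

/-- `K` as a real-linear map. -/
def kL : C2 →L[ℝ] C2 := LinearMap.toContinuousLinearMap
  { toFun := kC2
    map_add' := fun x y => by ext i; fin_cases i <;> simp [kC2] <;> ring
    map_smul' := fun r x => by
      ext i; fin_cases i <;> (simp [kC2]; ring) }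

@[simp] theorem jL_apply (z : C2) : jL z = jC2 z := rfl
@[simp] theorem kL_apply (z : C2) : kL z = kC2 z := rfl

theorem jL_jL (z : C2) : jL (jL z) = -z := by
  ext i; fin_cases i <;> simp [jC2]

theorem kL_kL (z : C2) : kL (kL z) = -z := by
  ext i; fin_cases i <;> simp [kC2, ← mul_assoc]

theorem kL_jL (z : C2) : kL (jL z) = -(Complex.I • z) := by
  ext i; fin_cases i <;> simp [kC2, jC2]

theorem jL_kL (z : C2) : jL (kL z) = Complex.I • z := by
  ext i; fin_cases i <;> simp [kC2, jC2]

theorem deriv_jCurve {f : S3 → ℂ} (hf : SmoothS3 f) (p : S3) :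
    deriv (fun t : ℝ => f (jCurve p t)) 0 = dS jL f p := by
  have h := (hasDerivAt_curve jL p jL_jL jCurve (fun _ _ => rfl) hf 0).deriv
  have h0 : jCurve p 0 = p := Subtype.ext (by simp [jCurve])
  rwa [h0] at h

theorem deriv_kCurve {f : S3 → ℂ} (hf : SmoothS3 f) (p : S3) :
    deriv (fun t : ℝ => f (kCurve p t)) 0 = dS kL f p := by
  have h := (hasDerivAt_curve kL p kL_kL kCurve (fun _ _ => rfl) hf 0).deriv
  have h0 : kCurve p 0 = p := Subtype.ext (by simp [kCurve])
  rwa [h0] at h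

theorem integral_dS_jL {f : S3 → ℂ} (hf : SmoothS3 f) : ∫ p, dS jL f p ∂μS3 = 0 :=
  integral_dS jL jL_jL jCurve (fun _ _ => rfl) hf

theorem integral_dS_kL {f : S3 → ℂ} (hf : SmoothS3 f) : ∫ p, dS kL f p ∂μS3 = 0 :=
  integral_dS kL kL_kL kCurve (fun _ _ => rfl) hf

/-! ### Functions invariant under the Hopf circle action -/

section invariant

variable {f : S3 → ℂ} (hf : SmoothS3 f) (hinv : ∀ c p, f (circ c p) = f p)
include hf hinv

theorem fderiv_vertical {z : C2} (hz : z ≠ 0) : fderiv ℝ (ext f) z (Complex.I • z) = 0 := by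
  let γ : ℝ → C2 := fun t => Complex.exp (t * Complex.I) • z
  have h1 : HasDerivAt γ (Complex.I • z) 0 := by
    have h2 : HasDerivAt (fun t : ℝ => Complex.exp (t * Complex.I)) Complex.I 0 := by
      have h3 : HasDerivAt (fun t : ℝ => (t : ℂ) * Complex.I) Complex.I 0 := by
        simpa using (Complex.ofRealCLM.hasDerivAt (x := (0 : ℝ))).mul_const Complex.I
      simpa using h3.cexp
    exact h2.smul_const z
  have hg0 : γ 0 = z := by simp [γ]
  have hd : DifferentiableAt ℝ (ext f) (γ 0) := by
    rw [hg0]; exact (hf.ext hz).differentiableAt (by simp)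
  have h3 := hd.hasFDerivAt.comp_hasDerivAt (0 : ℝ) h1
  have h4 : (ext f ∘ γ) = fun _ => ext f z := by
    funext t
    have hne : γ t ≠ 0 := smul_ne_zero (Complex.exp_ne_zero _) hz
    have : nrm (γ t) = circ (Circle.exp t) (nrm z) := by
      apply Subtype.ext
      rw [coe_nrm hne]
      simp only [circ, coe_nrm hz, γ, norm_smul, Complex.norm_exp_ofReal_mul_I, one_mul,
        Circle.coe_exp]
      rw [smul_comm]
    simp only [Function.comp, ext, this, hinv]
  rw [h4, hg0] at h3
  exact h3.unique (hasDerivAt_const _ _)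

/-- The bracket of the two horizontal fields is a multiple of the vertical field `i p`, which kills
circle-invariant functions. -/
theorem dS_jL_kL (p : S3) : dS jL (dS kL f) p = dS kL (dS jL f) p := by
  have h := dS_comm kL jL hf p
  rw [kL_jL, jL_kL, map_sub, map_neg, fderiv_vertical hf hinv (S3_ne_zero p)] at h
  simpa [sub_eq_zero] using h

/-- The vectors `z, iz, Jz, Kz` span `ℂ²` over `ℝ`. The extension has zero derivative along `z` by
homogeneity, along `iz` by invariance and along the other two by hypothesis, and `ℂ² ∖ 0` is
connected. -/
theorem eq_of_dS_eq_zero (hj : ∀ p, dS jL f p = 0) (hk : ∀ p, dS kL f p = 0) (p q : S3) :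
    f p = f q := by
  have hopen : IsOpen ({0}ᶜ : Set C2) := isOpen_compl_singleton
  have hconn : IsPreconnected ({0}ᶜ : Set C2) := by
    refine (isConnected_compl_singleton_of_one_lt_rank ?_ (0 : C2)).isPreconnected
    have : Module.rank ℝ C2 = (4 : ℕ) := by
      rw [← Module.finrank_eq_rank, finrankC2.out]
    rw [this]
    norm_num
  have hzero : ∀ z ∈ ({0}ᶜ : Set C2), fderiv ℝ (ext f) z = 0 := by
    intro z hz
    have hz' : z ≠ 0 := hz
    have hJ : fderiv ℝ (ext f) z (jC2 z) = 0 := by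
      rw [← jL_apply, ← ext_dS jL f hz']; exact hj _
    have hK : fderiv ℝ (ext f) z (kC2 z) = 0 := by
      rw [← kL_apply, ← ext_dS kL f hz']; exact hk _
    have hI := fderiv_vertical hf hinv hz'
    have hR : fderiv ℝ (ext f) z z = 0 := by
      have h1 : HasDerivAt (fun t : ℝ => Real.exp t • z) z 0 := by
        simpa using (Real.hasDerivAt_exp 0).smul_const z
      have hd : DifferentiableAt ℝ (ext f) (Real.exp 0 • z) := by
        simpa using (hf.ext hz').differentiableAt (by simp)
      have h3 := hd.hasFDerivAt.comp_hasDerivAt (0 : ℝ) h1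
      have h4 : (ext f ∘ fun t : ℝ => Real.exp t • z) = fun _ => ext f z := by
        funext t
        simp [ext, nrm_smul (Real.exp_pos t)]
      rw [h4] at h3
      simpa using h3.unique (hasDerivAt_const _ _)
    ext v
    obtain ⟨a, b, c, d, hv⟩ : ∃ a b c d : ℝ,
        (‖z‖ ^ 2) • v = a • z + b • (Complex.I • z) + c • jC2 z + d • kC2 z := by
      -- Real and imaginary parts of the hermitian products of `v` with `z` and with `J z`, using `K
      -- z = i (J z)`.
      refine ⟨(conj (z 0) * v 0 + conj (z 1) * v 1).re, (conj (z 0) * v 0 + conj (z 1) * v 1).im,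
        (z 0 * v 1 - z 1 * v 0).re, (z 0 * v 1 - z 1 * v 0).im, ?_⟩
      have hn : ‖z‖ ^ 2 = (z 0).re * (z 0).re + (z 0).im * (z 0).im +
          (z 1).re * (z 1).re + (z 1).im * (z 1).im := by
        rw [EuclideanSpace.norm_sq_eq, Fin.sum_univ_two, ← Complex.normSq_eq_norm_sq,
          ← Complex.normSq_eq_norm_sq, Complex.normSq_apply, Complex.normSq_apply]
        ring
      rw [hn]
      ext i
      fin_cases i <;> apply Complex.ext <;> simp [jC2, kC2] <;> ring
    have hn : ‖z‖ ^ 2 ≠ 0 := by simpa using hz'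
    have h5 := congrArg (fderiv ℝ (ext f) z) hv
    simp only [map_add, map_smul, hJ, hK, hI, hR, smul_zero, add_zero] at h5
    simpa [hz'] using h5
  have := hopen.is_const_of_fderiv_eq_zero hconn
    (fun z hz => ((hf.ext hz).differentiableAt (by simp)).differentiableWithinAt) hzero
    (S3_ne_zero p) (S3_ne_zero q)
  simpa using this

end invariant

/-! ### Matrix-valued functions on `S³` -/

section matrix

variable {n : Type*} [Fintype n] [DecidableEq n]

/-- A matrix-valued function on `S³` has smooth entries. -/
def SmoothMat (f : S3 → Matrix n n ℂ) : Prop := ∀ a b, SmoothS3 fun p => f p a b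

/-- The entrywise derivative along `p ↦ T p`. -/
def dM (T : C2 →L[ℝ] C2) (f : S3 → Matrix n n ℂ) (p : S3) : Matrix n n ℂ :=
  Matrix.of fun a b => dS T (fun q => f q a b) p

variable {f g : S3 → Matrix n n ℂ}

theorem dJ_eq (hf : SmoothMat f) : dJ f = dM jL f := by
  funext p; ext a b; exact deriv_jCurve (hf a b) p

theorem dK_eq (hf : SmoothMat f) : dK f = dM kL f := by
  funext p; ext a b; exact deriv_kCurve (hf a b) p

theorem smoothMat_const (A : Matrix n n ℂ) : SmoothMat fun _ => A := fun _ _ => smoothS3_const _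

theorem SmoothMat.add (hf : SmoothMat f) (hg : SmoothMat g) : SmoothMat fun p => f p + g p :=
  fun a b => (hf a b).add (hg a b)

theorem SmoothMat.mul (hf : SmoothMat f) (hg : SmoothMat g) : SmoothMat fun p => f p * g p :=
  fun a b => by
    simp only [Matrix.mul_apply]
    exact SmoothS3.sum _ fun i _ => (hf a i).mul (hg i b)

theorem SmoothMat.smul (c : ℂ) (hf : SmoothMat f) : SmoothMat fun p => c • f p :=
  fun a b => (smoothS3_const c).mul (hf a b)

theorem SmoothMat.neg (hf : SmoothMat f) : SmoothMat fun p => -f p := by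
  simpa using hf.smul (-1)

theorem SmoothMat.sub (hf : SmoothMat f) (hg : SmoothMat g) : SmoothMat fun p => f p - g p := by
  simpa [sub_eq_add_neg] using hf.add hg.neg

theorem SmoothMat.conjTranspose (hf : SmoothMat f) : SmoothMat fun p => (f p)ᴴ :=
  fun a b => (hf b a).conj

theorem SmoothMat.trace (hf : SmoothMat f) : SmoothS3 fun p => (f p).trace :=
  SmoothS3.sum _ fun i _ => hf i i

theorem SmoothMat.dM (hf : SmoothMat f) (T : C2 →L[ℝ] C2) : SmoothMat (dM T f) :=
  fun a b => (hf a b).dS T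

theorem SmoothMat.linear {m : Type*} [Fintype m] [DecidableEq m] (hf : SmoothMat f)
    (L : Matrix n n ℂ →ₗ[ℂ] Matrix m m ℂ) : SmoothMat fun p => L (f p) := by
  intro a b
  have : (fun p => L (f p) a b) =
      fun p => ∑ i, ∑ j, f p i j * L (Matrix.single i j 1) a b := by
    funext p
    conv_lhs => rw [Matrix.matrix_eq_sum_single (f p)]
    simp only [map_sum, Matrix.sum_apply]
    refine Finset.sum_congr rfl fun i _ => Finset.sum_congr rfl fun j _ => ?_
    rw [← smul_eq_mul, ← Matrix.smul_apply, ← map_smul, Matrix.smul_single, smul_eq_mul, mul_one]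
  rw [this]
  exact SmoothS3.sum _ fun i _ => SmoothS3.sum _ fun j _ => (hf i j).mul (smoothS3_const _)

section rules

variable (T : C2 →L[ℝ] C2) (p : S3)

theorem dM_const (A : Matrix n n ℂ) : dM T (fun _ => A) p = 0 := by
  ext a b; exact dS_const T p _

theorem dM_add (hf : SmoothMat f) (hg : SmoothMat g) :
    dM T (fun q => f q + g q) p = dM T f p + dM T g p := by
  ext a b; exact dS_add T p (hf a b) (hg a b)

theorem dM_mul (hf : SmoothMat f) (hg : SmoothMat g) :
    dM T (fun q => f q * g q) p = dM T f p * g p + f p * dM T g p := by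
  ext a b
  simp only [dM, Matrix.of_apply, Matrix.mul_apply, Matrix.add_apply]
  rw [dS_sum T p _ fun i _ => (hf a i).mul (hg i b), ← Finset.sum_add_distrib]
  exact Finset.sum_congr rfl fun i _ => dS_mul T p (hf a i) (hg i b)

theorem dM_smul (c : ℂ) (hf : SmoothMat f) : dM T (fun q => c • f q) p = c • dM T f p := by
  ext a b
  have := dS_mul T p (smoothS3_const c) (hf a b)
  rw [dS_const, zero_mul, zero_add] at this
  exact this

theorem dM_sub (hf : SmoothMat f) (hg : SmoothMat g) :
    dM T (fun q => f q - g q) p = dM T f p - dM T g p := by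
  have h := dM_add T p hf (hg.smul (-1))
  rw [dM_smul T p _ hg] at h
  simpa [sub_eq_add_neg] using h

theorem dM_conjTranspose (f : S3 → Matrix n n ℂ) : dM T (fun q => (f q)ᴴ) p = (dM T f p)ᴴ := by
  ext a b; exact dS_conj T p _

theorem dS_trace (hf : SmoothMat f) : dS T (fun q => (f q).trace) p = (dM T f p).trace :=
  dS_sum T p _ fun i _ => hf i i

theorem dM_linear {m : Type*} [Fintype m] [DecidableEq m] (hf : SmoothMat f)
    (L : Matrix n n ℂ →ₗ[ℂ] Matrix m m ℂ) : dM T (fun q => L (f q)) p = L (dM T f p) := by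
  have key : ∀ A : Matrix n n ℂ, ∀ a b, L A a b =
      ∑ i, ∑ j, A i j * L (Matrix.single i j 1) a b := by
    intro A a b
    conv_lhs => rw [Matrix.matrix_eq_sum_single A]
    simp only [map_sum, Matrix.sum_apply]
    refine Finset.sum_congr rfl fun i _ => Finset.sum_congr rfl fun j _ => ?_
    rw [← smul_eq_mul, ← Matrix.smul_apply, ← map_smul, Matrix.smul_single, smul_eq_mul, mul_one]
  ext a b
  rw [key (dM T f p)]
  simp only [dM, Matrix.of_apply]
  rw [funext fun q => key (f q) a b, dS_sum T p _ fun i _ =>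
    SmoothS3.sum _ fun j _ => (hf i j).mul (smoothS3_const _)]
  refine Finset.sum_congr rfl fun i _ => ?_
  rw [dS_sum T p _ fun j _ => (hf i j).mul (smoothS3_const _)]
  refine Finset.sum_congr rfl fun j _ => ?_
  rw [dS_mul T p (hf i j) (smoothS3_const _), dS_const]
  simp

end rules

/-! ### Rules for `∂` and `∂̄` -/

theorem dbar_eq (hf : SmoothMat f) (p : S3) :
    dbar f p = (1 / 2 : ℂ) • (dM jL f p + Complex.I • dM kL f p) := by
  rw [dbar, dJ_eq hf, dK_eq hf]

theorem del_eq (hf : SmoothMat f) (p : S3) :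
    del f p = (1 / 2 : ℂ) • (dM jL f p - Complex.I • dM kL f p) := by
  rw [del, dJ_eq hf, dK_eq hf]

theorem SmoothMat.dbar (hf : SmoothMat f) : SmoothMat (dbar f) := by
  rw [funext (dbar_eq hf)]
  exact ((hf.dM _).add ((hf.dM _).smul _)).smul _

theorem SmoothMat.del (hf : SmoothMat f) : SmoothMat (del f) := by
  rw [funext (del_eq hf)]
  exact ((hf.dM _).sub ((hf.dM _).smul _)).smul _

variable (p : S3)

theorem dbar_mul (hf : SmoothMat f) (hg : SmoothMat g) :
    dbar (fun q => f q * g q) p = dbar f p * g p + f p * dbar g p := by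
  rw [dbar_eq (hf.mul hg), dbar_eq hf, dbar_eq hg, dM_mul _ _ hf hg, dM_mul _ _ hf hg]
  simp only [smul_mul_assoc, mul_smul_comm, add_mul, mul_add]
  module

theorem del_mul (hf : SmoothMat f) (hg : SmoothMat g) :
    del (fun q => f q * g q) p = del f p * g p + f p * del g p := by
  rw [del_eq (hf.mul hg), del_eq hf, del_eq hg, dM_mul _ _ hf hg, dM_mul _ _ hf hg]
  simp only [smul_mul_assoc, mul_smul_comm, sub_mul, mul_sub]
  module

theorem dbar_add (hf : SmoothMat f) (hg : SmoothMat g) :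
    dbar (fun q => f q + g q) p = dbar f p + dbar g p := by
  rw [dbar_eq (hf.add hg), dbar_eq hf, dbar_eq hg, dM_add _ _ hf hg, dM_add _ _ hf hg]
  module

theorem dbar_sub (hf : SmoothMat f) (hg : SmoothMat g) :
    dbar (fun q => f q - g q) p = dbar f p - dbar g p := by
  rw [dbar_eq (hf.sub hg), dbar_eq hf, dbar_eq hg, dM_sub _ _ hf hg, dM_sub _ _ hf hg]
  module

theorem del_sub (hf : SmoothMat f) (hg : SmoothMat g) :
    del (fun q => f q - g q) p = del f p - del g p := by
  rw [del_eq (hf.sub hg), del_eq hf, del_eq hg, dM_sub _ _ hf hg, dM_sub _ _ hf hg]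
  module

theorem dbar_conjTranspose (hf : SmoothMat f) : dbar (fun q => (f q)ᴴ) p = (del f p)ᴴ := by
  rw [dbar_eq hf.conjTranspose, del_eq hf, dM_conjTranspose, dM_conjTranspose]
  simp [Matrix.conjTranspose_smul]

theorem dbar_del (hf : SmoothMat f) (hinv : ∀ c p, f (circ c p) = f p) :
    dbar (del f) p = del (dbar f) p := by
  have hcomm : dM jL (dM kL f) p = dM kL (dM jL f) p := by
    ext a b
    exact dS_jL_kL (hf a b) (fun c p => by simp only [hinv]) p
  rw [dbar_eq hf.del, del_eq hf.dbar, funext (del_eq hf), funext (dbar_eq hf),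
    dM_smul _ _ _ ((hf.dM _).sub ((hf.dM _).smul _)),
    dM_smul _ _ _ ((hf.dM _).sub ((hf.dM _).smul _)),
    dM_smul _ _ _ ((hf.dM _).add ((hf.dM _).smul _)),
    dM_smul _ _ _ ((hf.dM _).add ((hf.dM _).smul _)),
    dM_sub _ _ (hf.dM _) ((hf.dM _).smul _), dM_sub _ _ (hf.dM _) ((hf.dM _).smul _),
    dM_add _ _ (hf.dM _) ((hf.dM _).smul _), dM_add _ _ (hf.dM _) ((hf.dM _).smul _),
    dM_smul _ _ _ (hf.dM _), dM_smul _ _ _ (hf.dM _), hcomm]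
  module

theorem integral_trace_dbar (hf : SmoothMat f) : ∫ p, (dbar f p).trace ∂μS3 = 0 := by
  have h : (fun p => (dbar f p).trace) = fun p => (1 / 2 : ℂ) *
      (dS jL (fun q => (f q).trace) p + Complex.I * dS kL (fun q => (f q).trace) p) := by
    funext p
    rw [dbar_eq hf, dS_trace _ _ hf, dS_trace _ _ hf, Matrix.trace_smul, Matrix.trace_add,
      Matrix.trace_smul, smul_eq_mul, smul_eq_mul]
  have hj := (hf.trace.dS jL).continuous
  have hk := (hf.trace.dS kL).continuous
  rw [h, MeasureTheory.integral_const_mul,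
    MeasureTheory.integral_add (integrable_S3 hj) ((integrable_S3 hk).const_mul _),
    MeasureTheory.integral_const_mul, integral_dS_jL hf.trace, integral_dS_kL hf.trace]
  simp

/-! ### The Bochner identity -/

/-- The value on `J p` of the `(0,1)` part of the form with values `u` on `J p`, `v` on `K p`. -/
def part01 (u v : S3 → Matrix n n ℂ) (p : S3) : Matrix n n ℂ :=
  (1 / 2 : ℂ) • (u p + Complex.I • v p)

/-- The curvature of the connection with values `u` on `J p`, `v` on `K p`. -/
def curv (u v : S3 → Matrix n n ℂ) (p : S3) : Matrix n n ℂ :=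
  dJ v p - dK u p + (u p * v p - v p * u p)

section part01

variable {u v : S3 → Matrix n n ℂ} (hu : SmoothMat u) (hv : SmoothMat v)
  (su : ∀ p, (u p)ᴴ = -u p) (sv : ∀ p, (v p)ᴴ = -v p)

include hu hv in
theorem smoothMat_part01 : SmoothMat (part01 u v) := (hu.add (hv.smul _)).smul _

include su sv in
theorem part01_sub_conjTranspose : part01 u v p - (part01 u v p)ᴴ = u p := by
  simp only [part01, Matrix.conjTranspose_smul, Matrix.conjTranspose_add, su, sv]
  simp
  module

include su sv in
theorem part01_add_conjTranspose : part01 u v p + (part01 u v p)ᴴ = Complex.I • v p := by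
  simp only [part01, Matrix.conjTranspose_smul, Matrix.conjTranspose_add, su, sv]
  simp
  module

include hu hv su sv in
-- Substitute `u = a - a*` and `v = -i(a + a*)`, where `a` is the (0,1) part. The factor `-2i` comes
-- from passing from the frame `J, K` to the operators `∂, ∂̄`.
theorem curv_eq : curv u v p = (-2 * Complex.I) •
    (del (part01 u v) p + dbar (fun q => (part01 u v q)ᴴ) p +
      (part01 u v p * (part01 u v p)ᴴ - (part01 u v p)ᴴ * part01 u v p)) := by
  have ha := smoothMat_part01 hu hv
  have hu' : u = fun p => part01 u v p - (part01 u v p)ᴴ :=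
    funext fun p => (part01_sub_conjTranspose p su sv).symm
  have hv' : v = fun p => (-Complex.I) • (part01 u v p + (part01 u v p)ᴴ) :=
    funext fun p => by rw [part01_add_conjTranspose p su sv, smul_smul]; simp
  rw [curv, dJ_eq hv, dK_eq hu, del_eq ha, dbar_eq ha.conjTranspose]
  generalize part01 u v = a at *
  subst hu' 
  rw [hv', dM_smul _ _ _ (ha.add ha.conjTranspose), dM_add _ _ ha ha.conjTranspose,
    dM_sub _ _ ha ha.conjTranspose]
  beta_reduce
  generalize dM jL a p = x1
  generalize dM kL a p = x2
  generalize dM jL (fun q => (a q)ᴴ) p = x3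
  generalize dM kL (fun q => (a q)ᴴ) p = x4
  generalize (a p)ᴴ = b
  generalize a p = a
  simp only [mul_smul_comm, smul_mul_assoc, sub_mul, mul_sub, add_mul, mul_add]
  match_scalars <;> ring_nf <;> simp [Complex.I_sq]

end part01

end matrix

/-! ### The integrated Bochner formula -/

section bochner

variable {n : Type*} [Fintype n] [DecidableEq n]

/-- The square that the moment map contributes to the Bochner formula. -/
theorem trace_moment {k φ ψ : Matrix n n ℂ} (h : k * φ = ψ * k) :
    (kᴴ * ((ψ * ψᴴ - ψᴴ * ψ) * k - k * (φ * φᴴ - φᴴ * φ))).trace =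
      ((ψᴴ * k - k * φᴴ)ᴴ * (ψᴴ * k - k * φᴴ)).trace := by
  have h' : φᴴ * kᴴ = kᴴ * ψᴴ := by
    rw [← Matrix.conjTranspose_mul, h, Matrix.conjTranspose_mul]
  simp only [Matrix.conjTranspose_sub, Matrix.conjTranspose_mul, Matrix.conjTranspose_conjTranspose,
    sub_mul, mul_sub, Matrix.trace_sub]
  -- By the intertwining relation and cyclicity, the traces in `e1`, `e2` and `e3` all equal
  -- `tr(k*kφφ*)`; what remains of the two sides then agrees term by term.
  have e1 : (kᴴ * (ψᴴ * ψ * k)).trace = (kᴴ * (k * (φ * φᴴ))).trace := by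
    rw [mul_assoc ψᴴ, ← h, ← mul_assoc kᴴ, ← h', mul_assoc, Matrix.trace_mul_comm φᴴ]
    simp only [mul_assoc]
  have e2 : (φ * kᴴ * (ψᴴ * k)).trace = (kᴴ * (k * (φ * φᴴ))).trace := by
    rw [mul_assoc φ, ← mul_assoc kᴴ, ← h', Matrix.trace_mul_comm φ, mul_assoc, mul_assoc,
      Matrix.trace_mul_comm φᴴ]
    simp only [mul_assoc]
  have e3 : (kᴴ * ψ * (k * φᴴ)).trace = (kᴴ * (k * (φ * φᴴ))).trace := by
    rw [mul_assoc kᴴ, ← mul_assoc ψ, ← h, mul_assoc]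
  have e4 : (φ * kᴴ * (k * φᴴ)).trace = (kᴴ * (k * (φᴴ * φ))).trace := by
    rw [mul_assoc φ, Matrix.trace_mul_comm φ]
    simp only [mul_assoc]
  have e5 : (kᴴ * ψ * (ψᴴ * k)).trace = (kᴴ * (ψ * ψᴴ * k)).trace := by simp only [mul_assoc]
  rw [e1, e2, e3, e4, e5]

variable {k φ ψ u v u' v' : S3 → Matrix n n ℂ} {z : Matrix n n ℂ} {c : ℝ}

/-- If a complex gauge transformation `k` maps the solution `(u, v, φ)` of the moment map equation
to the solution `(u', v', ψ)`, then it is parallel and intertwines the adjoints of `φ` and `ψ`. -/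
theorem parallel_of_moment (hc : 0 < c) (hk : SmoothMat k) (hinv : ∀ c p, k (circ c p) = k p)
    (hφ : SmoothMat φ) (hψ : SmoothMat ψ)
    (hu : SmoothMat u) (hv : SmoothMat v) (hu' : SmoothMat u') (hv' : SmoothMat v')
    (su : ∀ p, (u p)ᴴ = -u p) (sv : ∀ p, (v p)ᴴ = -v p)
    (su' : ∀ p, (u' p)ᴴ = -u' p) (sv' : ∀ p, (v' p)ᴴ = -v' p)
    (h01 : ∀ p, dbar k p = k p * part01 u v p - part01 u' v' p * k p)
    (hkφ : ∀ p, k p * φ p = ψ p * k p)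
    (hz : ∀ p, k p * z = z * k p)
    (hF : ∀ p, curv u v p - (c : ℂ) • (Complex.I / 2) • (φ p * (φ p)ᴴ - (φ p)ᴴ * φ p) = z)
    (hF' : ∀ p, curv u' v' p - (c : ℂ) • (Complex.I / 2) • (ψ p * (ψ p)ᴴ - (ψ p)ᴴ * ψ p) = z)
    (p : S3) :
    dJ k p = k p * u p - u' p * k p ∧ dK k p = k p * v p - v' p * k p ∧
      (ψ p)ᴴ * k p = k p * (φ p)ᴴ := by
  have ha := smoothMat_part01 hu hv
  have hb := smoothMat_part01 hu' hv'
  have ca := fun p => curv_eq p hu hv su sv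
  have cb := fun p => curv_eq p hu' hv' su' sv'
  have ua := fun p => part01_sub_conjTranspose p su sv
  have va := fun p => part01_add_conjTranspose p su sv
  have ub := fun p => part01_sub_conjTranspose p su' sv'
  have vb := fun p => part01_add_conjTranspose p su' sv'
  generalize part01 u v = a at *
  generalize part01 u' v' = b at *
  -- The (1,0) part of the covariant derivative of `k`: by skewness the (1,0) parts of the two
  -- connections are `-a*` and `-b*`.
  let D : S3 → Matrix n n ℂ := fun p => del k p - (b p)ᴴ * k p + k p * (a p)ᴴ
  have hD : SmoothMat D := (hk.del.sub (hb.conjTranspose.mul hk)).add (hk.mul ha.conjTranspose)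
  let X : S3 → Matrix n n ℂ := fun p => (ψ p)ᴴ * k p - k p * (φ p)ᴴ
  have hX : SmoothMat X := (hψ.conjTranspose.mul hk).sub (hk.mul hφ.conjTranspose)
  -- Circle invariance of `k` gives `∂̄∂k = ∂∂̄k`, and then `∂̄k` is replaced by its algebraic
  -- expression from `h01`.
  have hdD : ∀ p, dbar D p = del k p * a p + k p * del a p - (del b p * k p + b p * del k p)
      - (dbar (fun q => (b q)ᴴ) p * k p + (b p)ᴴ * dbar k p)
      + (dbar k p * (a p)ᴴ + k p * dbar (fun q => (a q)ᴴ) p) := fun p => by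
    rw [dbar_add p (hk.del.sub (hb.conjTranspose.mul hk)) (hk.mul ha.conjTranspose),
      dbar_sub p hk.del (hb.conjTranspose.mul hk), dbar_mul p hb.conjTranspose hk,
      dbar_mul p hk ha.conjTranspose, dbar_del p hk hinv, funext h01,
      del_sub p (hk.mul ha) (hb.mul hk), del_mul p hk ha, del_mul p hb hk]
  have hcurv : ∀ p, dbar D p + b p * D p - D p * a p =
      (c / 4 : ℂ) • ((ψ p * (ψ p)ᴴ - (ψ p)ᴴ * ψ p) * k p -
        k p * (φ p * (φ p)ᴴ - (φ p)ᴴ * φ p)) := fun p => by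
    have key : dbar D p + b p * D p - D p * a p =
        k p * (del a p + dbar (fun q => (a q)ᴴ) p + (a p * (a p)ᴴ - (a p)ᴴ * a p)) -
        (del b p + dbar (fun q => (b q)ᴴ) p + (b p * (b p)ᴴ - (b p)ᴴ * b p)) * k p := by
      rw [hdD, h01]
      simp only [D]
      noncomm_ring
    -- Multiplication by `i/2` undoes the factor of `curv_eq`. Applied to the moment term `c
    -- (i/2)[φ, φ*]` it yields `-c/4`, the origin of the constant `c/4`.
    have hI : (Complex.I / 2) * (-2 * Complex.I) = 1 := by
      linear_combination -Complex.I_mul_I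
    have e1 := congrArg (fun x => (Complex.I / 2) • x) (ca p)
    have e2 := congrArg (fun x => (Complex.I / 2) • x) (cb p)
    simp only [smul_smul, hI, one_smul] at e1 e2
    rw [key, ← e1, ← e2, sub_eq_iff_eq_add.1 (hF p), sub_eq_iff_eq_add.1 (hF' p)]
    simp only [smul_add, mul_add, add_mul, mul_smul_comm, smul_mul_assoc, hz p]
    generalize z * k p = x1
    generalize k p * _ = x2
    generalize _ * k p = x3
    match_scalars
    · ring
    · linear_combination (c / 4 : ℂ) * Complex.I_mul_I
    · linear_combination (-c / 4 : ℂ) * Complex.I_mul_I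
  -- The Bochner formula: the Leibniz rule gives `|D|²` plus the trace of `k*` times the covariant
  -- `∂̄` of `D`, and the latter is the square from `trace_moment`.
  have hg : ∀ p, (dbar (fun q => (k q)ᴴ * D q) p).trace =
      ((D p)ᴴ * D p).trace + (c / 4 : ℂ) * ((X p)ᴴ * X p).trace := fun p => by
    rw [← trace_moment (hkφ p), ← smul_eq_mul (c / 4 : ℂ), ← Matrix.trace_smul, ← mul_smul_comm, ← hcurv,
      dbar_mul p hk.conjTranspose hD, dbar_conjTranspose p hk, ← Matrix.trace_add]
    have hd : (D p)ᴴ = (del k p)ᴴ - (k p)ᴴ * b p + a p * (k p)ᴴ := by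
      simp [D, Matrix.conjTranspose_mul]
    rw [hd]
    have e : (a p * ((k p)ᴴ * D p)).trace = ((k p)ᴴ * (D p * a p)).trace := by
      rw [Matrix.trace_mul_comm, mul_assoc]
    simp only [add_mul, sub_mul, mul_add, mul_sub, Matrix.trace_add, Matrix.trace_sub, mul_assoc, e]
    ring
  have pos : ∀ (Y : Matrix n n ℂ), 0 ≤ (Yᴴ * Y).trace := fun Y =>
    (Matrix.posSemidef_conjTranspose_mul_self Y).trace_nonneg
  have hc4 : (0 : ℂ) < c / 4 := by
    have : (0 : ℝ) < c / 4 := by positivity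
    exact_mod_cast this
  have hint := integral_trace_dbar (hk.conjTranspose.mul hD)
  have hzero := eq_zero_of_integral_eq_zero
    (g := fun p => (dbar (fun q => (k q)ᴴ * D q) p).trace)
    (hk.conjTranspose.mul hD).dbar.trace.continuous
    (fun p => by
      rw [hg]; exact add_nonneg (pos _) (mul_nonneg hc4.le (pos _))) hint p
  rw [hg] at hzero
  have hD0 : D p = 0 := by
    have := ((add_eq_zero_iff_of_nonneg (pos _) (mul_nonneg hc4.le (pos _))).1 hzero).1
    exact Matrix.trace_conjTranspose_mul_self_eq_zero_iff.1 this
  have hX0 : X p = 0 := by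
    have := ((add_eq_zero_iff_of_nonneg (pos _) (mul_nonneg hc4.le (pos _))).1 hzero).2
    exact Matrix.trace_conjTranspose_mul_self_eq_zero_iff.1
      ((mul_eq_zero.1 this).resolve_left hc4.ne')
  have hdel : del k p = (b p)ᴴ * k p - k p * (a p)ᴴ := by
    have : del k p - (b p)ᴴ * k p + k p * (a p)ᴴ = 0 := hD0
    rw [← sub_eq_zero, ← this]
    abel
  refine ⟨?_, ?_, sub_eq_zero.1 hX0⟩
  · have : dJ k p = dbar k p + del k p := by
      rw [dbar, del]; module
    rw [this, h01, hdel, ← ua, ← ub]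
    noncomm_ring
  · have : Complex.I • dK k p = dbar k p - del k p := by
      rw [dbar, del]; module
    have h2 : Complex.I • dK k p = Complex.I • (k p * v p - v' p * k p) := by
      rw [this, h01, hdel, smul_sub, ← mul_smul_comm, ← smul_mul_assoc, ← va, ← vb]
      noncomm_ring
    exact smul_right_injective _ Complex.I_ne_zero h2

end bochner

-- Used with `w` an eigenbasis, to evaluate polynomials on eigenvalues, and with `x = y`, to pass
-- commutation from an endomorphism to polynomials in it.
open Polynomial in
theorem aeval_semiconj {A : Type*} [Ring A] [Algebra ℂ A] {x y w : A} (h : x * w = w * y)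
    (q : ℂ[X]) : aeval x q * w = w * aeval y q := by
  induction q using Polynomial.induction_on' with
  | add f g hf hg => rw [map_add, map_add, add_mul, mul_add, hf, hg]
  | monomial k c =>
    have hs : SemiconjBy w (y ^ k) (x ^ k) := SemiconjBy.pow_right h.symm k
    rw [aeval_monomial, aeval_monomial, mul_assoc, ← hs.eq, Algebra.left_comm]

/-! ### Functional calculus of parallel endomorphisms -/

section parallel

variable {n : Type*} [Fintype n] [DecidableEq n] {f g H u v : S3 → Matrix n n ℂ}

/-! ### Smoothness of the inverse -/

theorem SmoothMat.det (hf : SmoothMat f) : SmoothS3 fun p => (f p).det := by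
  simp only [Matrix.det_apply']
  exact SmoothS3.sum _ fun σ _ => (smoothS3_const _).mul (SmoothS3.prod _ fun i _ => hf _ _)

/-- Cramer's rule expresses the inverse smoothly. -/
theorem SmoothMat.of_mul_eq_one (hf : SmoothMat f) (h : ∀ p, f p * g p = 1) : SmoothMat g := by
  have hdet : ∀ p, (f p).det ≠ 0 := fun p h0 => by
    have := congrArg Matrix.det (h p)
    rw [Matrix.det_mul, h0] at this
    simp at this
  have hg : ∀ p, g p = (f p).det⁻¹ • (f p).adjugate := fun p => by
    rw [← Matrix.inv_eq_right_inv (h p), Matrix.inv_def, Ring.inverse_eq_inv']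
  intro a b
  simp only [hg, Matrix.smul_apply, smul_eq_mul, Matrix.adjugate_apply]
  refine (hf.det.inv hdet).mul (SmoothMat.det fun i j => ?_)
  simp only [Matrix.updateRow_apply]
  split_ifs
  · exact smoothS3_const _
  · exact hf i j

/-! ### Polynomials in a parallel endomorphism -/

open Polynomial

theorem smoothMat_aeval (hH : SmoothMat H) (q : ℂ[X]) : SmoothMat fun p => aeval (H p) q := by
  induction q using Polynomial.induction_on' with
  | add f g hf hg => simpa only [map_add] using hf.add hg
  | monomial k c =>
    simp only [aeval_monomial, Algebra.algebraMap_eq_smul_one, smul_mul_assoc, one_mul]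
    refine SmoothMat.smul c ?_
    induction k with
    | zero => simpa using smoothMat_const 1
    | succ k ih => simpa only [pow_succ] using ih.mul hH

/-- Differentiation and the commutator with `u` are both derivations, so polynomials in a parallel
endomorphism are parallel. -/
theorem dM_aeval (T : C2 →L[ℝ] C2) (hH : SmoothMat H)
    (hp : ∀ p, dM T H p = H p * u p - u p * H p) (q : ℂ[X]) (p : S3) :
    dM T (fun p => aeval (H p) q) p = aeval (H p) q * u p - u p * aeval (H p) q := by
  induction q using Polynomial.induction_on' with
  | add f g hf hg =>
    simp only [map_add]
    rw [dM_add _ _ (smoothMat_aeval hH f) (smoothMat_aeval hH g), hf, hg]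
    noncomm_ring
  | monomial k c =>
    have hs : ∀ k, SmoothMat fun p => H p ^ k := fun k => by
      simpa using smoothMat_aeval hH (X ^ k)
    simp only [aeval_monomial, Algebra.algebraMap_eq_smul_one, smul_mul_assoc, one_mul,
      mul_smul_comm, ← smul_sub]
    rw [dM_smul _ _ _ (hs k)]
    congr 1
    induction k with
    | zero => simpa using dM_const T p 1
    | succ k ih =>
      simp only [pow_succ]
      rw [dM_mul _ _ (hs k) hH, ih, hp]
      noncomm_ring

/-- The target connection `w` cancels because it is skew, leaving a parallel endomorphism of the
source. -/
theorem dM_conjTranspose_mul_self (T : C2 →L[ℝ] C2) (hf : SmoothMat f)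
    (su : ∀ p, (u p)ᴴ = -u p) {w : S3 → Matrix n n ℂ} (sw : ∀ p, (w p)ᴴ = -w p)
    (hp : ∀ p, dM T f p = f p * u p - w p * f p) (p : S3) :
    dM T (fun p => (f p)ᴴ * f p) p = (f p)ᴴ * f p * u p - u p * ((f p)ᴴ * f p) := by
  rw [dM_mul _ _ hf.conjTranspose hf, dM_conjTranspose, hp]
  simp only [Matrix.conjTranspose_sub, Matrix.conjTranspose_mul, su, sw]
  noncomm_ring

/-- A polynomial that annihilates a parallel endomorphism at one point annihilates it
everywhere. -/
theorem aeval_eq_zero_of_parallel (hH : SmoothMat H) (hinv : ∀ c p, H (circ c p) = H p)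
    (su : ∀ p, (u p)ᴴ = -u p) (sv : ∀ p, (v p)ᴴ = -v p)
    (hu : ∀ p, dM jL H p = H p * u p - u p * H p) (hv : ∀ p, dM kL H p = H p * v p - v p * H p)
    (q : ℂ[X]) {p₀ : S3} (h0 : aeval (H p₀) q = 0) (p : S3) : aeval (H p) q = 0 := by
  have hQ := smoothMat_aeval hH q
  have hQu := dM_aeval jL hH hu q
  have hQv := dM_aeval kL hH hv q
  have hQQ := hQ.conjTranspose.mul hQ
  -- With `Q` the polynomial in `H`, the norm `tr(Q*Q)` has the trace of a commutator as its
  -- derivative, so it is constant, and it vanishes at `p₀`.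
  have key := eq_of_dS_eq_zero hQQ.trace (fun c p => by simp only [hinv])
    (fun p => by
      rw [dS_trace _ _ hQQ, dM_conjTranspose_mul_self jL hQ su su hQu, Matrix.trace_sub,
        Matrix.trace_mul_comm, sub_self])
    (fun p => by
      rw [dS_trace _ _ hQQ, dM_conjTranspose_mul_self kL hQ sv sv hQv, Matrix.trace_sub,
        Matrix.trace_mul_comm, sub_self]) p p₀
  rw [h0] at key
  exact Matrix.trace_conjTranspose_mul_self_eq_zero_iff.1 (by simpa using key)

/-- A polynomial whose values at the roots of `m` are the inverse square roots of the roots. -/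
def invSqrtPoly (m : ℂ[X]) : ℂ[X] :=
  Lagrange.interpolate m.roots.toFinset id fun z => ((Real.sqrt z.re)⁻¹ : ℂ)

theorem eval_invSqrtPoly {m : ℂ[X]} (hm : m ≠ 0) {d : ℝ} (hd : 0 < d)
    (h : m.eval ((d : ℂ) * d) = 0) : (invSqrtPoly m).eval ((d : ℂ) * d) = (d : ℂ)⁻¹ := by
  have hmem : (d : ℂ) * d ∈ m.roots.toFinset := by simp [hm, h]
  have := Lagrange.eval_interpolate_at_node (s := m.roots.toFinset) (v := id)
    (fun z : ℂ => ((Real.sqrt z.re)⁻¹ : ℂ)) (Function.injective_id.injOn) hmem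
  rw [invSqrtPoly]
  simp only [id] at this
  rw [this, ← Complex.ofReal_mul, Complex.ofReal_re, Real.sqrt_mul_self hd.le]

theorem aeval_diagonal (d : n → ℂ) (q : ℂ[X]) :
    aeval (Matrix.diagonal d) q = Matrix.diagonal fun i => q.eval (d i) := by
  have := aeval_algHom_apply (Matrix.diagonalAlgHom ℂ (n := n) (α := ℂ)) d q
  rw [Matrix.diagonalAlgHom_apply, Matrix.diagonalAlgHom_apply] at this
  rw [this]
  congr 1
  funext i
  simp [coe_aeval_eq_eval]

/-- In the eigenbasis `w`, each `d i ^ 2` is a root of `m`, where the interpolating polynomial takes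
the value `(d i)⁻¹`. Only `m` enters the polynomial, so one polynomial serves all `A` with `m(A²) =
0`. -/
theorem aeval_invSqrtPoly {A : Matrix n n ℂ} {m : ℂ[X]} (hm : m ≠ 0) (hA : aeval (A * A) m = 0)
    {w w' : Matrix n n ℂ} (hw : w * w' = 1) {d : n → ℝ} (hd : ∀ i, 0 < d i)
    (hAw : A * w = w * Matrix.diagonal fun i => (d i : ℂ)) :
    aeval (A * A) (invSqrtPoly m) * A = 1 := by
  have hw' : w' * w = 1 := mul_eq_one_comm.1 hw
  have h2 : A * A * w = w * Matrix.diagonal fun i => (d i : ℂ) * d i := by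
    rw [mul_assoc, hAw, ← mul_assoc, hAw, mul_assoc, Matrix.diagonal_mul_diagonal]
  have h3 := aeval_semiconj h2
  have hroot : ∀ i, m.eval ((d i : ℂ) * d i) = 0 := fun i => by
    have h4 := h3 m
    rw [hA, zero_mul, aeval_diagonal] at h4
    have h5 := congrArg (fun x => w' * x) h4
    simp only [mul_zero, ← mul_assoc, hw', one_mul] at h5
    simpa using (congrFun (congrFun h5 i) i).symm
  have h6 : aeval (A * A) (invSqrtPoly m) * A * w = w := by
    rw [mul_assoc, hAw, ← mul_assoc, h3, aeval_diagonal, mul_assoc, Matrix.diagonal_mul_diagonal]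
    have : (fun i => (invSqrtPoly m).eval ((d i : ℂ) * d i) * (d i : ℂ)) = fun _ => 1 := by
      funext i
      rw [eval_invSqrtPoly hm (hd i) (hroot i)]
      exact inv_mul_cancel₀ (by exact_mod_cast (hd i).ne')
    rw [this, Matrix.diagonal_one, mul_one]
  calc _ = aeval (A * A) (invSqrtPoly m) * A * w * w' := by rw [mul_assoc _ w, hw, mul_one]
    _ = 1 := by rw [h6, hw]

end parallel

section algebra

variable {Γ : Subgroup SU2} {ι : Type*} [Fintype ι] [DecidableEq ι]

/-! ### Endomorphisms of `V` as matrices -/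

/-- The matrix of an endomorphism of `V` in the orthonormal basis of elementary matrices. -/
def toM : (Matrix ι ι ℂ →ₗ[ℂ] Matrix ι ι ℂ) ≃ₐ[ℂ] Matrix (ι × ι) (ι × ι) ℂ :=
  LinearMap.toMatrixAlgEquiv (Matrix.stdBasis ℂ ι ι)

theorem toM_apply (L : Matrix ι ι ℂ →ₗ[ℂ] Matrix ι ι ℂ) (i j : ι × ι) :
    toM L i j = L (Matrix.single j.1 j.2 1) i.1 i.2 := by
  rw [toM, LinearMap.toMatrixAlgEquiv_apply]
  have : Matrix.stdBasis ℂ ι ι j = Matrix.single j.1 j.2 1 := Matrix.stdBasis_eq_single ..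
  rw [this]
  rfl

/-- The endomorphism `X ↦ A X B`. -/
def lr (A B : Matrix ι ι ℂ) : Matrix ι ι ℂ →ₗ[ℂ] Matrix ι ι ℂ :=
  LinearMap.mulLeft ℂ A ∘ₗ LinearMap.mulRight ℂ B

@[simp] theorem lr_apply (A B X : Matrix ι ι ℂ) : lr A B X = A * (X * B) := rfl

theorem toM_lr (A B : Matrix ι ι ℂ) (i j : ι × ι) :
    toM (lr A B) i j = A i.1 j.1 * B j.2 i.2 := by
  rw [toM_apply, lr_apply, ← mul_assoc, Matrix.mul_single_eq_updateCol_zero]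
  simp [Matrix.mul_apply, Matrix.updateCol_apply]

theorem toM_lr_conjTranspose (A B : Matrix ι ι ℂ) : (toM (lr A B))ᴴ = toM (lr Aᴴ Bᴴ) := by
  ext i j
  simp [toM_lr]

theorem toM_lr_mul (A B C D : Matrix ι ι ℂ) :
    toM (lr A B) * toM (lr C D) = toM (lr (A * C) (D * B)) := by
  rw [← map_mul]
  congr 1
  ext1 X
  simp [mul_assoc]

theorem toM_lr_one : toM (lr (1 : Matrix ι ι ℂ) 1) = 1 := by
  rw [← map_one toM]
  congr 1
  ext1 X
  simp

theorem coe_conjGL (f : GL ι ℂ) : (conjGL f : Matrix ι ι ℂ →ₗ[ℂ] Matrix ι ι ℂ) =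
    lr (f : Matrix ι ι ℂ) ((f⁻¹ : GL ι ℂ) : Matrix ι ι ℂ) := by
  ext1 X
  simp [conjGL, mul_assoc]

/-- The matrix of `X ↦ A X - X A`, as a linear function of `A`. -/
def adM : Matrix ι ι ℂ →ₗ[ℂ] Matrix (ι × ι) (ι × ι) ℂ :=
  toM.toLinearMap ∘ₗ (LinearMap.mul ℂ (Matrix ι ι ℂ) - (LinearMap.mul ℂ (Matrix ι ι ℂ)).flip)

theorem adM_symm_apply (A X : Matrix ι ι ℂ) : toM.symm (adM A) X = ⁅A, X⁆ := by
  simp [adM, Ring.lie_def]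

theorem adM_eq (A : Matrix ι ι ℂ) : adM A = toM (lr A 1) - toM (lr 1 A) := by
  rw [← map_sub]
  apply toM.symm.injective
  ext1 X
  simp [adM_symm_apply, Ring.lie_def]

theorem adM_conjTranspose (A : Matrix ι ι ℂ) : (adM A)ᴴ = adM Aᴴ := by
  simp [adM_eq, toM_lr_conjTranspose]

theorem adM_commutator (A B : Matrix ι ι ℂ) :
    adM (A * B - B * A) = adM A * adM B - adM B * adM A := by
  apply toM.symm.injective
  ext1 X
  simp only [map_sub, map_mul, LinearMap.sub_apply, Module.End.mul_apply, adM_symm_apply,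
    Ring.lie_def]
  noncomm_ring

/-- Conjugation is an algebra automorphism, so it transports commutators. -/
theorem toM_conjGL_mul_adM (f : GL ι ℂ) (A : Matrix ι ι ℂ) :
    toM (conjGL f : Matrix ι ι ℂ →ₗ[ℂ] Matrix ι ι ℂ) * adM A =
      adM (conjGL f A) * toM (conjGL f : Matrix ι ι ℂ →ₗ[ℂ] Matrix ι ι ℂ) := by
  apply toM.symm.injective
  ext1 X
  simp [adM_symm_apply, Ring.lie_def, conjGL, mul_assoc, mul_sub, sub_mul]

theorem trace_conjGL (f : GL ι ℂ) (A : Matrix ι ι ℂ) : (conjGL f A).trace = A.trace := by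
  change ((f : Matrix ι ι ℂ) * A * ((f⁻¹ : GL ι ℂ) : Matrix ι ι ℂ)).trace = _
  rw [Matrix.trace_mul_comm, ← mul_assoc, Units.inv_mul, one_mul]

/-- The kernel of `ad` consists of the scalars, and the trace detects these. -/
theorem eq_of_adM_eq {A B : Matrix ι ι ℂ} (h : adM A = adM B) (ht : A.trace = B.trace) :
    A = B := by
  have h0 : ∀ X, (A - B) * X = X * (A - B) := fun X => by
    have h1 : ⁅A, X⁆ = ⁅B, X⁆ := by rw [← adM_symm_apply, h, adM_symm_apply]
    rw [Ring.lie_def, Ring.lie_def] at h1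
    rw [sub_mul, mul_sub, ← sub_eq_zero]
    rw [← sub_eq_zero] at h1
    rw [← h1]
    abel
  obtain ⟨s, hs⟩ := Matrix.mem_range_scalar_iff_commute_single'.2
    (fun i j => (h0 (Matrix.single i j 1)).symm : ∀ i j, Commute (Matrix.single i j 1) (A - B))
  cases isEmpty_or_nonempty ι
  · ext i; exact isEmptyElim i
  · have h2 := congrArg Matrix.trace hs
    rw [Matrix.trace_sub, ht, sub_self] at h2
    have h3 : s = 0 := by simpa [Matrix.trace] using h2
    rw [h3, map_zero] at hs
    exact (sub_eq_zero.1 hs.symm)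

/-! ### The commutant of `Γ` and polar decompositions -/

variable {R : Γ →* Matrix.unitaryGroup ι ℂ} {A B : Matrix ι ι ℂ}

theorem conjTranspose_rep (γ : Γ) : (R γ : Matrix ι ι ℂ)ᴴ = (R γ⁻¹ : Matrix ι ι ℂ) := by
  rw [map_inv]; rfl

theorem CommutesWith.conjTranspose (h : CommutesWith R A) : CommutesWith R Aᴴ := fun γ => by
  have := congrArg Matrix.conjTranspose (h γ⁻¹)
  rw [Matrix.conjTranspose_mul, Matrix.conjTranspose_mul, conjTranspose_rep, inv_inv] at this
  exact this.symm

theorem CommutesWith.mul (hA : CommutesWith R A) (hB : CommutesWith R B) :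
    CommutesWith R (A * B) := fun γ => by
  rw [mul_assoc, hB γ, ← mul_assoc, hA γ, mul_assoc]

theorem CommutesWith.add (hA : CommutesWith R A) (hB : CommutesWith R B) :
    CommutesWith R (A + B) := fun γ => by rw [add_mul, mul_add, hA γ, hB γ]

theorem CommutesWith.smul (c : ℂ) (hA : CommutesWith R A) : CommutesWith R (c • A) := fun γ => by
  rw [smul_mul_assoc, mul_smul_comm, hA γ]

theorem commutesWith_one : CommutesWith R (1 : Matrix ι ι ℂ) := fun γ => by
  rw [one_mul, mul_one]

theorem CommutesWith.inv {f : GL ι ℂ} (h : CommutesWith R (f : Matrix ι ι ℂ)) :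
    CommutesWith R ((f⁻¹ : GL ι ℂ) : Matrix ι ι ℂ) := fun γ => by
  calc _ = ((f⁻¹ : GL ι ℂ) : Matrix ι ι ℂ) * ((R γ : Matrix ι ι ℂ) * f) *
        ((f⁻¹ : GL ι ℂ) : Matrix ι ι ℂ) := by
        rw [mul_assoc, mul_assoc (R γ : Matrix ι ι ℂ), Units.mul_inv, mul_one]
    _ = _ := by rw [← h γ, ← mul_assoc, Units.inv_mul, one_mul]

/-- The centre of `𝔣 / 𝔱` is central in the commutant of `Γ`. -/
theorem commute_of_mem_centreFT {z : Matrix ι ι ℂ} (hz : z ∈ centreFT R)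
    (hA : CommutesWith R A) : z * A = A * z := by
  cases isEmpty_or_nonempty ι
  · ext i; exact isEmptyElim i
  have skew : ∀ {C : Matrix ι ι ℂ}, CommutesWith R C → Cᴴ = -C → z * C = C * z := by
    intro C hC hs
    have hcard : (Fintype.card ι : ℂ) ≠ 0 := by simp
    have htr : conj C.trace = -C.trace := by
      have := congrArg Matrix.trace hs
      rwa [Matrix.trace_conjTranspose, Matrix.trace_neg] at this
    -- Removing the scalar part puts `C` in `𝔣 / 𝔱` without changing its commutator with `z`.
    have hmem : C + (-(C.trace / Fintype.card ι)) • (1 : Matrix ι ι ℂ) ∈ lieFT R := by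
      refine ⟨?_, hC.add (commutesWith_one.smul _), ?_⟩
      · rw [Matrix.conjTranspose_add, hs, Matrix.conjTranspose_smul, Matrix.conjTranspose_one]
        simp [htr, neg_div]
        abel
      · rw [Matrix.trace_add, Matrix.trace_smul, Matrix.trace_one, smul_eq_mul]
        field_simp
        ring
    have := hz.2 _ hmem
    simpa [mul_add, add_mul] using this
  have h1 : z * (A + (-1 : ℂ) • Aᴴ) = (A + (-1 : ℂ) • Aᴴ) * z :=
    skew (hA.add (hA.conjTranspose.smul _)) (by simp)
  have h2 : z * (Complex.I • (A + Aᴴ)) = (Complex.I • (A + Aᴴ)) * z :=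
    skew ((hA.add hA.conjTranspose).smul _) (by
      rw [Matrix.conjTranspose_smul, Matrix.conjTranspose_add, Matrix.conjTranspose_conjTranspose]
      simp [add_comm])
  have hdec : A = (1 / 2 : ℂ) • (A + (-1 : ℂ) • Aᴴ) + (-Complex.I / 2) • (Complex.I • (A + Aᴴ)) := by
    rw [smul_smul]
    have : -Complex.I / 2 * Complex.I = 1 / 2 := by
      linear_combination (-1 / 2 : ℂ) * Complex.I_mul_I
    rw [this]
    module
  conv_lhs => rw [hdec]
  conv_rhs => rw [hdec]
  rw [mul_add, add_mul, mul_smul_comm, smul_mul_assoc, h1, mul_smul_comm, smul_mul_assoc, h2]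

/-- Polar decomposition in the commutant of `Γ`, with a diagonalization of the positive part. -/
theorem exists_polar (f : GL ι ℂ) (hf : CommutesWith R (f : Matrix ι ι ℂ)) :
    ∃ (u h : GL ι ℂ) (U : Matrix ι ι ℂ) (d : ι → ℝ), (u : Matrix ι ι ℂ) ∈ Matrix.unitaryGroup ι ℂ ∧
      CommutesWith R (u : Matrix ι ι ℂ) ∧ (h : Matrix ι ι ℂ).PosDef ∧
      CommutesWith R (h : Matrix ι ι ℂ) ∧ f = u * h ∧ U * Uᴴ = 1 ∧ (∀ i, 0 < d i) ∧
      (h : Matrix ι ι ℂ) = U * Matrix.diagonal (fun i => (d i : ℂ)) * Uᴴ := by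
  obtain ⟨F, hF⟩ : ∃ F : Matrix ι ι ℂ, (f : Matrix ι ι ℂ) = F := ⟨_, rfl⟩
  have hFu : IsUnit F := hF ▸ f.isUnit
  rw [hF] at hf
  have hS : (Fᴴ * F).PosDef := by
    have := (Matrix.IsUnit.posDef_star_left_conjugate_iff (U := F) hFu
      (x := (1 : Matrix ι ι ℂ))).2 Matrix.PosDef.one
    simpa [Matrix.star_eq_conjTranspose] using this
  obtain ⟨U, e, hU, hU', he, hSU⟩ : ∃ (U : Matrix ι ι ℂ) (e : ι → ℝ), U * Uᴴ = 1 ∧ Uᴴ * U = 1 ∧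
      (∀ i, 0 < e i) ∧ Fᴴ * F = U * Matrix.diagonal (fun i => (e i : ℂ)) * Uᴴ := by
    refine ⟨hS.1.eigenvectorUnitary, hS.1.eigenvalues,
      Matrix.mem_unitaryGroup_iff.1 hS.1.eigenvectorUnitary.2,
      Matrix.mem_unitaryGroup_iff'.1 hS.1.eigenvectorUnitary.2, hS.eigenvalues_pos, ?_⟩
    conv_lhs => rw [hS.1.spectral_theorem]
    rw [Unitary.conjStarAlgAut_apply]
    rfl
  let d : ι → ℝ := fun i => Real.sqrt (e i)
  have hd : ∀ i, 0 < d i := fun i => Real.sqrt_pos.2 (he i)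
  have hdd : ∀ i, (d i : ℂ) * d i = e i := fun i => by
    rw [← Complex.ofReal_mul, Real.mul_self_sqrt (he i).le]
  let D : Matrix ι ι ℂ := Matrix.diagonal fun i => (d i : ℂ)
  let D' : Matrix ι ι ℂ := Matrix.diagonal fun i => ((d i)⁻¹ : ℂ)
  have hd0 : ∀ i, (d i : ℂ) ≠ 0 := fun i => by exact_mod_cast (hd i).ne'
  have hDD' : D * D' = 1 := by
    simp [D, D', Matrix.diagonal_mul_diagonal, hd0]
  have hD'D : D' * D = 1 := mul_eq_one_comm.1 hDD'
  have conj_mul : ∀ X Y : Matrix ι ι ℂ, U * X * Uᴴ * (U * Y * Uᴴ) = U * (X * Y) * Uᴴ := by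
    intro X Y
    calc _ = U * X * (Uᴴ * U) * Y * Uᴴ := by simp only [mul_assoc]
      _ = _ := by rw [hU', mul_one]; simp only [mul_assoc]
  let h : GL ι ℂ := ⟨U * D * Uᴴ, U * D' * Uᴴ, by rw [conj_mul, hDD', mul_one, hU],
    by rw [conj_mul, hD'D, mul_one, hU]⟩
  have hh : (h : Matrix ι ι ℂ) = U * D * Uᴴ := rfl
  have hhh : (h : Matrix ι ι ℂ) * h = Fᴴ * F := by
    rw [hh, conj_mul, hSU, Matrix.diagonal_mul_diagonal]
    simp only [hdd]
  have hUu : IsUnit U := ⟨⟨U, Uᴴ, hU, hU'⟩, rfl⟩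
  have hpos : (h : Matrix ι ι ℂ).PosDef := by
    rw [hh]
    refine (Matrix.IsUnit.posDef_star_right_conjugate_iff hUu).2 ?_
    exact Matrix.posDef_diagonal_iff.2 fun i => by exact_mod_cast hd i
  -- In the eigenbasis, a nonzero entry `N i j` of a matrix commuting with `F*F` forces `e i = e j`,
  -- hence equal square roots, so `N` commutes with `D` too.
  have hcomm : CommutesWith R (h : Matrix ι ι ℂ) := by
    intro γ
    have hS' := (hf.conjTranspose.mul hf) γ
    rw [hSU] at hS'
    set r : Matrix ι ι ℂ := (R γ : Matrix ι ι ℂ)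
    let N : Matrix ι ι ℂ := Uᴴ * r * U
    have hr : r = U * N * Uᴴ := by
      calc r = (U * Uᴴ) * r * (U * Uᴴ) := by rw [hU, one_mul, mul_one]
        _ = _ := by simp only [N, mul_assoc]
    have hinj : ∀ X Y : Matrix ι ι ℂ, U * X * Uᴴ = U * Y * Uᴴ → X = Y := by
      intro X Y hXY
      have := congrArg (fun x => Uᴴ * x * U) hXY
      have cancel : ∀ X : Matrix ι ι ℂ, Uᴴ * (U * X * Uᴴ) * U = X := fun X => by
        calc _ = (Uᴴ * U) * X * (Uᴴ * U) := by simp only [mul_assoc]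
          _ = X := by rw [hU', one_mul, mul_one]
      simpa only [cancel] using this
    rw [hr, conj_mul, conj_mul] at hS'
    have hN := hinj _ _ hS'
    rw [hh, hr, conj_mul, conj_mul]
    congr 2
    ext i j
    have hij := congrFun (congrFun hN i) j
    simp only [Matrix.diagonal_mul, Matrix.mul_diagonal, D] at hij ⊢
    by_cases h0 : N i j = 0
    · simp [h0]
    · have : e i = e j := by
        rw [mul_comm] at hij
        exact_mod_cast mul_left_cancel₀ h0 hij
      simp only [d, this]
      ring
  refine ⟨f * h⁻¹, h, U, d, ?_, by rw [Units.val_mul, hF]; exact hf.mul hcomm.inv, hpos, hcomm, by simp, hU, hd, rfl⟩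
  rw [Matrix.mem_unitaryGroup_iff', Matrix.star_eq_conjTranspose]
  have hinv : ((h⁻¹ : GL ι ℂ) : Matrix ι ι ℂ)ᴴ * h = 1 := by
    have := congrArg Matrix.conjTranspose (h.mul_inv)
    rwa [Matrix.conjTranspose_mul, hpos.1.eq, Matrix.conjTranspose_one] at this
  rw [Units.val_mul, hF, Matrix.conjTranspose_mul]
  calc _ = ((h⁻¹ : GL ι ℂ) : Matrix ι ι ℂ)ᴴ * (Fᴴ * F) * ((h⁻¹ : GL ι ℂ) : Matrix ι ι ℂ) := by
        simp only [mul_assoc]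
    _ = ((h⁻¹ : GL ι ℂ) : Matrix ι ι ℂ)ᴴ * h * (h * ((h⁻¹ : GL ι ℂ) : Matrix ι ι ℂ)) := by
        rw [← hhh]; simp only [mul_assoc]
    _ = 1 := by rw [hinv, Units.mul_inv, one_mul]

end algebra

section gauge

variable {Γ : Subgroup SU2} {ι : Type*} [Fintype ι] [DecidableEq ι]
  {R : Γ →* Matrix.unitaryGroup ι ℂ}

/-! ### Smoothness of the values of one-forms on the horizontal frame -/

theorem smoothS3_coord (i : Fin 2) : SmoothS3 fun p => (p : C2) i :=
  smoothS3_of (fun z => z i)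
    (fun _ _ => ((EuclideanSpace.proj (𝕜 := ℂ) i).restrictScalars ℝ).contDiff.contDiffAt)
    fun _ => rfl

theorem SmoothS3.re {f : S3 → ℂ} (hf : SmoothS3 f) : SmoothS3 fun p => ((f p).re : ℂ) := by
  simp only [Complex.re_eq_add_conj, div_eq_mul_inv]
  exact (hf.add hf.conj).mul (smoothS3_const _)

theorem SmoothS3.im {f : S3 → ℂ} (hf : SmoothS3 f) : SmoothS3 fun p => ((f p).im : ℂ) := by
  have : (fun p => ((f p).im : ℂ)) = fun p => (((-Complex.I) * f p).re : ℂ) := by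
    funext p; simp
  rw [this]
  exact ((smoothS3_const _).mul hf).re

/-- The smoothness of a form is given on constant vectors only, so the moving vector is expanded in
a real basis of `ℂ²`. -/
theorem OneForm.smoothMat (B : OneForm R) {w : S3 → C2} (hw : ∀ i, SmoothS3 fun p => w p i) :
    SmoothMat fun p => B.toFun p (w p) := by
  intro a b
  let e (i : Fin 2) : C2 := EuclideanSpace.single i 1
  have hdec : ∀ z : C2, z = (z 0).re • e 0 + (z 0).im • (Complex.I • e 0) + (z 1).re • e 1 +
      (z 1).im • (Complex.I • e 1) := fun z => by
    ext i
    fin_cases i <;> apply Complex.ext <;> simp [e]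
  have : (fun p => B.toFun p (w p) a b) = fun p =>
      ((w p 0).re : ℂ) * B.toFun p (e 0) a b + ((w p 0).im : ℂ) * B.toFun p (Complex.I • e 0) a b +
      ((w p 1).re : ℂ) * B.toFun p (e 1) a b +
      ((w p 1).im : ℂ) * B.toFun p (Complex.I • e 1) a b := by
    funext p
    conv_lhs => rw [hdec (w p)]
    simp only [map_add, map_smul, Matrix.add_apply, Matrix.smul_apply, Complex.real_smul]
  rw [this]
  exact (((((hw 0).re.mul (B.smooth _ a b)).add ((hw 0).im.mul (B.smooth _ a b))).add
    ((hw 1).re.mul (B.smooth _ a b)))).add ((hw 1).im.mul (B.smooth _ a b))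

theorem OneForm.smooth_onJ (B : OneForm R) : SmoothMat B.onJ :=
  B.smoothMat (w := fun p => jC2 p) fun i => by
    fin_cases i
    · simpa [jC2] using (smoothS3_const (-1)).mul (smoothS3_coord 1).conj
    · simpa [jC2] using (smoothS3_coord 0).conj

theorem OneForm.smooth_onK (B : OneForm R) : SmoothMat B.onK :=
  B.smoothMat (w := fun p => kC2 p) fun i => by
    fin_cases i
    · simpa [kC2] using (smoothS3_const (-Complex.I)).mul (smoothS3_coord 1).conj
    · simpa [kC2] using (smoothS3_const Complex.I).mul (smoothS3_coord 0).conj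

/-! ### The adjoint form of sections, connections and gauge transformations -/

theorem SmoothMat.adM {f : S3 → Matrix ι ι ℂ} (hf : SmoothMat f) : SmoothMat fun p => adM (f p) :=
  hf.linear _

theorem adM_skew {f : S3 → Matrix ι ι ℂ} (hf : ∀ p, (f p)ᴴ = -f p) (p : S3) :
    (adM (f p))ᴴ = -adM (f p) := by rw [adM_conjTranspose, hf, map_neg]

theorem OneForm.onJ_skew (B : OneForm R) (p : S3) : (B.onJ p)ᴴ = -B.onJ p := (B.mem_lie _ _).1

theorem OneForm.onK_skew (B : OneForm R) (p : S3) : (B.onK p)ᴴ = -B.onK p := (B.mem_lie _ _).1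

theorem OneForm.adM_part01 (B : OneForm R) (p : S3) :
    ALE.part01 (fun p => adM (B.onJ p)) (fun p => adM (B.onK p)) p = adM (B.part01 p) := by
  simp only [ALE.part01, OneForm.part01, map_smul, map_add]

theorem OneForm.adM_curvature (B : OneForm R) (p : S3) :
    curv (fun p => adM (B.onJ p)) (fun p => adM (B.onK p)) p = adM (B.curvature p) := by
  rw [curv, OneForm.curvature, dJ_eq B.smooth_onK.adM, dK_eq B.smooth_onJ.adM, dJ_eq B.smooth_onK,
    dK_eq B.smooth_onJ, dM_linear _ _ B.smooth_onK, dM_linear _ _ B.smooth_onJ, map_add, map_sub,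
    adM_commutator]

/-- The matrix of a gauge transformation. -/
def gM (κ : S3 → Matrix ι ι ℂ ≃ₗ[ℂ] Matrix ι ι ℂ) (p : S3) : Matrix (ι × ι) (ι × ι) ℂ :=
  toM (κ p : Matrix ι ι ℂ →ₗ[ℂ] Matrix ι ι ℂ)

variable {κ : S3 → Matrix ι ι ℂ ≃ₗ[ℂ] Matrix ι ι ℂ}

theorem gM_mul_inv (κ : S3 → Matrix ι ι ℂ ≃ₗ[ℂ] Matrix ι ι ℂ) (p : S3) :
    gM κ p * gM κ⁻¹ p = 1 := by
  rw [gM, gM, ← map_mul, ← map_one toM]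
  congr 1
  ext1 X
  exact (κ p).apply_symm_apply X

theorem gM_inv_mul (κ : S3 → Matrix ι ι ℂ ≃ₗ[ℂ] Matrix ι ι ℂ) (p : S3) :
    gM κ⁻¹ p * gM κ p = 1 := mul_eq_one_comm.1 (gM_mul_inv κ p)

theorem symm_gM (κ : S3 → Matrix ι ι ℂ ≃ₗ[ℂ] Matrix ι ι ℂ) (p : S3) (X : Matrix ι ι ℂ) :
    toM.symm (gM κ p) X = κ p X := by simp [gM]

theorem smoothMat_gM (h : ∀ X a b, SmoothS3 fun p => κ p X a b) : SmoothMat (gM κ) :=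
  fun i j => by
    simp only [gM, toM_apply]
    exact h _ _ _

/-- Evaluation at `X` of the endomorphism with a given matrix. -/
def evalM (X : Matrix ι ι ℂ) : Matrix (ι × ι) (ι × ι) ℂ →ₗ[ℂ] Matrix ι ι ℂ :=
  LinearMap.applyₗ X ∘ₗ toM.symm.toLinearMap

theorem evalM_apply (X : Matrix ι ι ℂ) (A : Matrix (ι × ι) (ι × ι) ℂ) :
    evalM X A = toM.symm A X := rfl

theorem dM_apply (T : C2 →L[ℝ] C2) (h : SmoothMat (gM κ)) (X : Matrix ι ι ℂ) (p : S3) :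
    dM T (fun q => κ q X) p = evalM X (dM T (gM κ) p) := by
  rw [← dM_linear T p h (evalM X)]
  simp only [evalM_apply, symm_gM]

theorem smoothMat_apply (h : SmoothMat (gM κ)) (X : Matrix ι ι ℂ) :
    SmoothMat fun q => κ q X := by
  simpa only [evalM_apply, symm_gM] using h.linear (evalM X)

theorem dbar_apply (h : SmoothMat (gM κ)) (X : Matrix ι ι ℂ) (p : S3) :
    dbar (fun q => κ q X) p = evalM X (dbar (gM κ) p) := by
  rw [dbar_eq (smoothMat_apply h X), dbar_eq h, dM_apply _ h, dM_apply _ h]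
  simp only [map_smul, map_add]

/-- A complex gauge transformation intertwines the `∂̄`-operators. -/
theorem ComplexAct.dbar_gM {B B' : OneForm R} {Θ Θ' : OrbSection R}
    (h : ComplexAct κ B Θ B' Θ') (hs : SmoothMat (gM κ)) (p : S3) :
    dbar (gM κ) p = gM κ p * adM (B.part01 p) - adM (B'.part01 p) * gM κ p := by
  have hs' : SmoothMat (gM κ⁻¹) := hs.of_mul_eq_one (gM_mul_inv κ)
  have e1 : adM (B'.part01 p) =
      gM κ p * (adM (B.part01 p) * gM κ⁻¹ p) + gM κ p * dbar (gM κ⁻¹) p := by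
    apply toM.symm.injective
    ext1 X
    rw [adM_symm_apply, (h.1 p X).1]
    have := dbar_apply hs' X p
    simp only [Pi.inv_apply] at this
    rw [this]
    simp only [map_add, map_mul, LinearMap.add_apply, Module.End.mul_apply, symm_gM, adM_symm_apply,
      evalM_apply, Pi.inv_apply]
  -- Differentiate `κ κ⁻¹ = 1` to eliminate the derivative of the inverse.
  have e2 : dbar (gM κ) p * gM κ⁻¹ p + gM κ p * dbar (gM κ⁻¹) p = 0 := by
    rw [← dbar_mul p hs hs', funext (gM_mul_inv κ), dbar_eq (smoothMat_const 1), dM_const, dM_const]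
    simp
  have e3 : gM κ p * dbar (gM κ⁻¹) p = -(dbar (gM κ) p * gM κ⁻¹ p) := by
    rw [← sub_eq_zero, ← e2]
    abel
  rw [e1, e3, add_mul, neg_mul, mul_assoc (dbar (gM κ) p), gM_inv_mul, ← mul_assoc,
    mul_assoc _ (gM κ⁻¹ p), gM_inv_mul, mul_one, mul_one]
  abel

/-- The action of a gauge transformation that intertwines the covariant derivatives. -/
theorem lie_eq_of_dM {ρ : S3 → Matrix ι ι ℂ ≃ₗ[ℂ] Matrix ι ι ℂ} (T : C2 →L[ℝ] C2)
    (hs : SmoothMat (gM ρ)) {A A' : Matrix ι ι ℂ} {p : S3}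
    (h : dM T (gM ρ) p = gM ρ p * adM A - adM A' * gM ρ p) (X : Matrix ι ι ℂ) :
    ⁅A', X⁆ = ρ p ⁅A, (ρ p)⁻¹ X⁆ + ρ p (dM T (fun q => (ρ q)⁻¹ X) p) := by
  have hs' : SmoothMat (gM ρ⁻¹) := hs.of_mul_eq_one (gM_mul_inv ρ)
  have e2 : dM T (gM ρ) p * gM ρ⁻¹ p + gM ρ p * dM T (gM ρ⁻¹) p = 0 := by
    rw [← dM_mul _ _ hs hs', funext (gM_mul_inv ρ), dM_const]
  have e1 : adM A' = gM ρ p * (adM A * gM ρ⁻¹ p) + gM ρ p * dM T (gM ρ⁻¹) p := by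
    rw [h, sub_mul, mul_assoc (adM A'), gM_mul_inv, mul_one] at e2
    rw [← sub_eq_zero, ← neg_eq_zero, ← e2]
    noncomm_ring
  have := dM_apply T hs' X p
  simp only [Pi.inv_apply] at this
  rw [← adM_symm_apply, e1, this]
  simp only [map_add, map_mul, LinearMap.add_apply, Module.End.mul_apply, symm_gM, adM_symm_apply,
    evalM_apply, Pi.inv_apply]

end gauge

end ALE

end

/-! ### The uniqueness theorem -/

open ALE in
theorem corollary5p7 (Γ : Subgroup ALE.SU2) [Finite Γ] {ι : Type*} [Fintype ι] [DecidableEq ι]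
    (R : Γ →* Matrix.unitaryGroup ι ℂ) (hR : ALE.IsRegular R)
    (c : ℝ) (hc : 0 < c)
    (ζ : Fin 3 → Matrix ι ι ℂ) (hζ : ∀ i, ζ i ∈ ALE.centreFT R)
    (B₁ B₂ : ALE.OneForm R) (Θ₁ Θ₂ : ALE.OrbSection R)
    (hB₁ : B₁ ∈ ALE.connTau R) (hB₂ : B₂ ∈ ALE.connTau R)
    (h₁ : ALE.IsSolution c ζ B₁ Θ₁) (h₂ : ALE.IsSolution c ζ B₂ Θ₂)
    (κ : ALE.S3 → Matrix ι ι ℂ ≃ₗ[ℂ] Matrix ι ι ℂ) (hκ : κ ∈ ALE.gaugeTauC R)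
    (hact : ALE.ComplexAct κ B₁ Θ₁ B₂ Θ₂) :
    ∃ ρ ∈ ALE.gaugeTau R, ALE.IsUnitaryPart R κ ρ ∧ ALE.UnitaryAct ρ B₁ Θ₁ B₂ Θ₂ := by
  obtain ⟨⟨hsm, hcirc, hgam⟩, hmem, htau⟩ := hκ
  -- These lifts to `F^c` are chosen pointwise, with no regularity; smoothness is only ever used for
  -- `gM κ`.
  choose f hfR hκf using hmem
  have hK : SmoothMat (gM κ) := smoothMat_gM hsm
  have hKc : ∀ c p, gM κ (circ c p) = gM κ p := fun c p => by rw [gM, hcirc, gM]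
  have hF : ∀ {B : OneForm R} {Θ : OrbSection R}, IsSolution c ζ B Θ → ∀ p,
      curv (fun p => adM (B.onJ p)) (fun p => adM (B.onK p)) p - (c : ℂ) • (Complex.I / 2) •
        (adM (Θ.toFun p) * (adM (Θ.toFun p))ᴴ - (adM (Θ.toFun p))ᴴ * adM (Θ.toFun p)) =
      (c : ℂ) • adM (ζ 0) := fun {B Θ} h p => by
    rw [B.adM_curvature, adM_conjTranspose, ← adM_commutator, ← map_smul, ← map_smul, ← map_sub,
      ← map_smul, ← h.moment₁ p, Ring.lie_def]
  have hKΘ : ∀ p, gM κ p * adM (Θ₁.toFun p) = adM (Θ₂.toFun p) * gM κ p := fun p => by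
    rw [hact.2, gM, hκf, toM_conjGL_mul_adM]
  have hKζ : ∀ p, gM κ p * ((c : ℂ) • adM (ζ 0)) = (c : ℂ) • adM (ζ 0) * gM κ p := fun p => by
    have hfix : conjGL (f p) (ζ 0) = ζ 0 := by
      change (f p : Matrix ι ι ℂ) * ζ 0 * ((f p)⁻¹ : GL ι ℂ) = ζ 0
      rw [← commute_of_mem_centreFT (hζ 0) (hfR p), mul_assoc, Units.mul_inv, mul_one]
    rw [mul_smul_comm, smul_mul_assoc, gM, hκf, toM_conjGL_mul_adM, hfix]
  have hmain := parallel_of_moment hc hK hKc (φ := fun p => adM (Θ₁.toFun p))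
    (ψ := fun p => adM (Θ₂.toFun p)) (SmoothMat.adM fun a b => Θ₁.smooth a b)
    (SmoothMat.adM fun a b => Θ₂.smooth a b) B₁.smooth_onJ.adM B₁.smooth_onK.adM
    B₂.smooth_onJ.adM B₂.smooth_onK.adM (adM_skew B₁.onJ_skew) (adM_skew B₁.onK_skew)
    (adM_skew B₂.onJ_skew) (adM_skew B₂.onK_skew)
    (fun p => by rw [hact.dbar_gM hK, B₁.adM_part01, B₂.adM_part01]) hKΘ hKζ (hF h₁) (hF h₂)
  have hKJ : ∀ p, dM jL (gM κ) p = gM κ p * adM (B₁.onJ p) - adM (B₂.onJ p) * gM κ p :=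
    fun p => by rw [← dJ_eq hK]; exact (hmain p).1
  have hKK : ∀ p, dM kL (gM κ) p = gM κ p * adM (B₁.onK p) - adM (B₂.onK p) * gM κ p :=
    fun p => by rw [← dK_eq hK]; exact (hmain p).2.1
  set H : S3 → Matrix (ι × ι) (ι × ι) ℂ := fun p => (gM κ p)ᴴ * gM κ p with hHdef
  have hH : SmoothMat H := hK.conjTranspose.mul hK
  have hHJ := dM_conjTranspose_mul_self jL hK (adM_skew B₁.onJ_skew) (adM_skew B₂.onJ_skew) hKJ
  have hHK := dM_conjTranspose_mul_self kL hK (adM_skew B₁.onK_skew) (adM_skew B₂.onK_skew) hKK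
  have hHΘ : ∀ p, H p * adM (Θ₁.toFun p) = adM (Θ₁.toFun p) * H p := fun p => by
    have h3 := congrArg Matrix.conjTranspose (hmain p).2.2
    simp only [Matrix.conjTranspose_mul, Matrix.conjTranspose_conjTranspose] at h3
    rw [hHdef]
    simp only
    rw [mul_assoc, hKΘ, ← mul_assoc, h3, mul_assoc]
  let p₀ : S3 := ⟨_, e0_mem⟩
  -- The characteristic polynomial at one base point annihilates `H` everywhere, since `H` is
  -- parallel.
  let m : Polynomial ℂ := (H p₀).charpoly
  have hm : m ≠ 0 := (Matrix.charpoly_monic _).ne_zero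
  have hmH : ∀ p, Polynomial.aeval (H p) m = 0 :=
    aeval_eq_zero_of_parallel hH (fun c p => by simp only [hHdef, hKc])
      (adM_skew B₁.onJ_skew) (adM_skew B₁.onK_skew) hHJ hHK m
      (Matrix.aeval_self_charpoly (H p₀))
  let Q : S3 → Matrix (ι × ι) (ι × ι) ℂ := fun p => Polynomial.aeval (H p) (invSqrtPoly m)
  have hQ : SmoothMat Q := smoothMat_aeval hH _
  choose u h U d huU huR hpos hhR hfuh hU hd hhU using fun p => exists_polar (f p) (hfR p)
  let ρ : S3 → Matrix ι ι ℂ ≃ₗ[ℂ] Matrix ι ι ℂ := fun p => conjGL (u p)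
  -- Conjugation by the positive part `h` is a positive operator `P` on `V` with `P² = H`, so `Q =
  -- P⁻¹`. This formula makes `ρ` smooth although `u`, `h`, `U`, `d` are chosen pointwise.
  have hρ : ∀ p, gM ρ p = gM κ p * Q p := fun p => by
    have hinvH : ((h p)⁻¹ : GL ι ℂ).valᴴ = ((h p)⁻¹ : GL ι ℂ).val := by
      rw [Matrix.coe_units_inv, Matrix.conjTranspose_nonsing_inv, (hpos p).1.eq]
    have hκuh : gM κ p = gM ρ p * toM (lr (h p).val ((h p)⁻¹ : GL ι ℂ).val) := by
      rw [gM, hκf, hfuh, coe_conjGL, gM, coe_conjGL, toM_lr_mul, mul_inv_rev]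
      rfl
    have hρu : (gM ρ p)ᴴ * gM ρ p = 1 := by
      have h1 : (u p).valᴴ * (u p).val = 1 := Matrix.mem_unitaryGroup_iff'.1 (huU p)
      have h2 : ((u p)⁻¹ : GL ι ℂ).val = (u p).valᴴ := by
        rw [Matrix.coe_units_inv]; exact Matrix.inv_eq_left_inv h1
      rw [gM, coe_conjGL, toM_lr_conjTranspose, toM_lr_mul, h2, Matrix.conjTranspose_conjTranspose,
        h1, toM_lr_one]
    have hHP : H p = toM (lr (h p).val ((h p)⁻¹ : GL ι ℂ).val) *
        toM (lr (h p).val ((h p)⁻¹ : GL ι ℂ).val) := by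
      simp only [hHdef]
      rw [hκuh, Matrix.conjTranspose_mul, toM_lr_conjTranspose, hinvH, (hpos p).1.eq, mul_assoc,
        ← mul_assoc _ (gM ρ p), hρu, one_mul]
    have hUU : (U p)ᴴ * U p = 1 := mul_eq_one_comm.1 (hU p)
    -- Conjugation by `h` has eigenvectors `U E_ij U*` with eigenvalues `d i / d j`.
    have hdiag : toM (lr (h p).val ((h p)⁻¹ : GL ι ℂ).val) * toM (lr (U p) (U p)ᴴ) =
        toM (lr (U p) (U p)ᴴ) *
          Matrix.diagonal fun i : ι × ι => ((d p i.1 / d p i.2 : ℝ) : ℂ) := by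
      have hd0 : ∀ i, (d p i : ℂ) ≠ 0 := fun i => by exact_mod_cast (hd p i).ne'
      have hinv : ((h p)⁻¹ : GL ι ℂ).val =
          U p * Matrix.diagonal (fun i => ((d p i)⁻¹ : ℂ)) * (U p)ᴴ := by
        rw [Matrix.coe_units_inv]
        apply Matrix.inv_eq_left_inv
        rw [hhU p]
        calc _ = U p * (Matrix.diagonal (fun i => ((d p i)⁻¹ : ℂ)) * ((U p)ᴴ * U p) *
              Matrix.diagonal (fun i => (d p i : ℂ))) * (U p)ᴴ := by simp only [mul_assoc]
          _ = 1 := by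
            rw [hUU, mul_one, Matrix.diagonal_mul_diagonal]
            simp [hd0, hU p]
      have hD : Matrix.diagonal (fun i : ι × ι => ((d p i.1 / d p i.2 : ℝ) : ℂ)) =
          toM (lr (Matrix.diagonal fun i => (d p i : ℂ))
            (Matrix.diagonal fun i => ((d p i)⁻¹ : ℂ))) := by
        ext i j
        rw [toM_lr, Matrix.diagonal_apply, Matrix.diagonal_apply, Matrix.diagonal_apply]
        rcases i with ⟨i, i'⟩
        rcases j with ⟨j, j'⟩
        by_cases e1 : i = j <;> by_cases e2 : i' = j' <;>
          simp [e1, e2, div_eq_mul_inv, eq_comm]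
      rw [hD, toM_lr_mul, toM_lr_mul, hinv, hhU p, mul_assoc _ (U p)ᴴ, hUU, mul_one,
        ← mul_assoc, ← mul_assoc, hUU, one_mul]
    have hw : toM (lr (U p) (U p)ᴴ) * toM (lr (U p)ᴴ (U p)) = 1 := by
      rw [toM_lr_mul, hU, toM_lr_one]
    have hQP := aeval_invSqrtPoly hm (hHP ▸ hmH p) hw
      (d := fun i : ι × ι => d p i.1 / d p i.2) (fun i => div_pos (hd p _) (hd p _)) hdiag
    rw [← hHP] at hQP
    rw [hκuh, mul_assoc, mul_eq_one_comm.1 hQP, mul_one]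
  have hρs : SmoothMat (gM ρ) := by
    rw [funext hρ]; exact hK.mul hQ
  -- The polynomial in `Q` is the same at all points, so `ρ p` is a function of `κ p` alone; the
  -- circle, `Γ` and `τ` invariances all follow from this.
  have hρ_eq : ∀ {p q}, κ p = κ q → ρ p = ρ q := fun {p q} hpq => by
    have hg : gM ρ p = gM ρ q := by
      rw [hρ, hρ]
      simp only [Q, hHdef, gM, hpq]
    ext1 X
    rw [← symm_gM, hg, symm_gM]
  have hρd : ∀ (T : C2 →L[ℝ] C2) (a b : S3 → Matrix ι ι ℂ) (p : S3),
      (∀ p, dM T (gM κ) p = gM κ p * adM (a p) - adM (b p) * gM κ p) →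
      (∀ p, dM T H p = H p * adM (a p) - adM (a p) * H p) →
      dM T (gM ρ) p = gM ρ p * adM (a p) - adM (b p) * gM ρ p := fun T a b p hab hT => by
    rw [funext hρ, dM_mul _ _ hK hQ, hab, dM_aeval T hH hT]
    noncomm_ring
  refine ⟨ρ, ⟨⟨fun X a b => smoothMat_apply hρs X a b, fun c p => hρ_eq (hcirc c p),
    fun γ hγ p => hρ_eq (hgam γ hγ p)⟩, fun p => ⟨u p, huU p, huR p, rfl⟩,
    fun p => hρ_eq (htau p)⟩,
    fun p => ⟨u p, h p, huU p, huR p, hpos p, hhR p, by rw [hκf, hfuh], rfl⟩,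
    fun p X => ⟨?_, ?_⟩, fun p => ?_⟩
  · have hs' : SmoothMat fun q => (ρ q)⁻¹ X :=
      smoothMat_apply (hρs.of_mul_eq_one (gM_mul_inv ρ)) X
    have := lie_eq_of_dM jL hρs (hρd jL _ _ p hKJ hHJ) X
    rw [← dJ_eq hs'] at this
    exact this
  · have hs' : SmoothMat fun q => (ρ q)⁻¹ X :=
      smoothMat_apply (hρs.of_mul_eq_one (gM_mul_inv ρ)) X
    have := lie_eq_of_dM kL hρs (hρd kL _ _ p hKK hHK) X
    rw [← dK_eq hs'] at this
    exact this
  -- `ad Θ₂` and `ad (ρ Θ₁)` agree by the intertwining relation for `ρ`. The remaining scalar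
  -- vanishes because `κ` and `ρ` both act by conjugation, so both images of `Θ₁` have its trace.
  · apply eq_of_adM_eq
    · have h3 : gM ρ p * adM (Θ₁.toFun p) = adM (Θ₂.toFun p) * gM ρ p := by
        rw [hρ, mul_assoc, aeval_semiconj (hHΘ p), ← mul_assoc, hKΘ, mul_assoc]
      have h4 := toM_conjGL_mul_adM (u p) (Θ₁.toFun p)
      have h5 := h4.symm.trans h3
      have h6 := congrArg (fun x => x * gM ρ⁻¹ p) h5
      simp only [mul_assoc] at h6
      change adM (ρ p (Θ₁.toFun p)) * (gM ρ p * gM ρ⁻¹ p) = _ at h6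
      rw [gM_mul_inv, mul_one, mul_one] at h6
      exact h6.symm
    · rw [hact.2, hκf]
      exact (trace_conjGL _ _).trans (trace_conjGL _ _).symm
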